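/- **Conventions.** A real function $f$ that is $C^\infty$ near a point $P\in\mathbb R^n$ is *$k$-determined* at $P$ if every function $g$, smooth near $P$, with the same $k$-jet at $P$ (all derivatives of order $0,\dots,k$ agree at $P$) satisfies $g=f\circ\varphi$ near $P$ for some local $C^\infty$ diffeomorphism $\varphi$ with $\varphi(P)=P$. Subscripts denote partial derivatives, evaluated at the critical point. **Symmetric potentials.** Let $V(x,y,z,w)$ be real valued and smooth near $P_0=(x_0,y_0,0,0)$, with $V(x,y,-z,-w)=V(x,y,z,w)$ near $P_0$ and $\nabla V(P_0)=0$. Let $\mathbb H$ be the Hessian of $V$ at $P_0$, $\mathbb H_1$ its upper left $2\times2$ block (variables $x,y$) and $\mathbb H_2$ its lower right $2\times 2$ block (variables $z,w$). Assume that $\mathbb H_1$ is positive definite and $V_{zz}\neq0$. Put $\alpha=V_{zw}/V_{zz}$ and $$\mathrm D^2V=\alpha^2V_{zz}-2\alpha V_{zw}+V_{ww},\qquad \mathrm D^3V=\alpha^3V_{zzz}-3\alpha^2V_{zzw}+3\alpha V_{zww}-V_{www},$$ $$\mathrm D^4V=\alpha^4V_{zzzz}-4\alpha^3V_{zzzw}+6\alpha^2V_{zzww}-4\alpha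 V_{zwww}+V_{wwww},$$ $$\kappa_1=\alpha^2V_{xzz}-2\alpha V_{xzw}+V_{xww},\quad \kappa_2=\alpha^2V_{yzz}-2\alpha V_{yzw}+V_{yww},\quad \kappa_3=\alpha^2V_{zzz}-2\alpha V_{zzw}+V_{zww}.$$ Let $\mathbb M$ be the upper left $3\times3$ submatrix of $\mathbb H$, $\mathrm M=\det\mathbb M$, and $\mathrm M_{ij}$ the $(i,j)$ minor of $\mathbb M$. Consider the two equations $$\det\mathbb H_2=V_{zz}V_{ww}-V_{zw}^2=0,\tag{1}$$ $$(V_{xx}V_{yy}-V_{xy}^2)\,\mathrm D^4V-3(\kappa_1^2V_{yy}-2\kappa_1\kappa_2V_{xy}+\kappa_2^2V_{xx})=0.\tag{2}$$ Then: 1. $\mathbb H$ is block diagonal, $\mathbb H=\mathrm{diag}(\mathbb H_1,\mathbb H_2)$. 2. The general conditions $\mathrm D^2V=0$, $\mathrm D^3V=0$, $\mathrm M\,\mathrm D^4V-3\sum_{i,j=1}^3(-1)^{i+j}\mathrm M_{ij}\kappa_i\kappa_j=0$ reduce to (1) and (2): the first is equivalent to (1), the second always holds, the third is equivalent to (2).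 3. $V$ is not 2-determined at $P_0$ if and only if (1) holds. 4. If $V$ is not 2-determined at $P_0$, then it is automatically not 3-determined; so $V$ is not 3-determined if and only if (1) holds. 5. $V$ is not 4-determined at $P_0$ if and only if (1) and (2) both hold. **Two order parameters.** Let $V=\tfrac12y^2+\tfrac12z^2+g(x,w)$, where $g$ is smooth near $(x_0,0)$, $g(x,-w)=g(x,w)$ near $(x_0,0)$, $\nabla g(x_0,0)=0$ and $g_{xx}>0$ at $(x_0,0)$. At $(x_0,0,0,0)$ the left sides of (1) and (2) equal $g_{ww}$ and $g_{xx}g_{wwww}-3g_{xww}^2$. Thus $V$ is not 2-determined there if and only if $g_{ww}=0$, not 3-determined if and only if $g_{ww}=0$, and not 4-determined if and only if $g_{ww}=0$ and $g_{xx}g_{wwww}-3g_{xww}^2=0$. **One order parameter.** Let $V=\tfrac12x^2+\tfrac12y^2+\tfrac12z^2+f(w)$, where $f$ is smooth near $0$ and $f(-w)=f(w)$ near $0$. At the origin the left sides of (1) and (2) equal $f_{ww}$ and $f_{wwww}$. Thus $V$ is not 2-determined there if and only if $f_{ww}=0$, not 3-determined if and only if $f_{ww}=0$, and not 4-determined if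 and only if $f_{ww}=f_{wwww}=0$. -/

import Mathlib

open Filter Topology
open scoped Manifold ContDiff

namespace Tricritical

/-- `f` represents a smooth germ at `p`: it is `C^∞` on a neighbourhood of `p`. -/
def IsSmoothGerm {E F : Type*} [NormedAddCommGroup E] [NormedSpace ℝ E]
    [NormedAddCommGroup F] [NormedSpace ℝ F] (f : E → F) (p : E) : Prop :=
  ∀ᶠ x in 𝓝 p, ContDiffAt ℝ ∞ f x

/-- `f` and `g` have the same `k`-jet (Taylor expansion up to and including order `k`) at `p`. -/
def SameJet {E : Type*} [NormedAddCommGroup E] [NormedSpace ℝ E]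
    (k : ℕ) (f g : E → ℝ) (p : E) : Prop :=
  ∀ i ≤ k, iteratedFDeriv ℝ i f p = iteratedFDeriv ℝ i g p

/-- The germs of `f` and `g` at `p` are diffeomorphic: near `p` one has `g = f ∘ φ` for a germ
`φ` of a smooth diffeomorphism fixing `p`. -/
def GermDiffeomorphic {E : Type*} [NormedAddCommGroup E] [NormedSpace ℝ E]
    (f g : E → ℝ) (p : E) : Prop :=
  ∃ φ : E → E, φ p = p ∧ IsLocalDiffeomorphAt 𝓘(ℝ, E) 𝓘(ℝ, E) ∞ φ p ∧ g =ᶠ[𝓝 p] f ∘ φ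

/-- The germ of `f` at `p` is `k`-determined: every smooth germ with the same `k`-jet at `p` is
diffeomorphic to it. -/
def IsDetermined {E : Type*} [NormedAddCommGroup E] [NormedSpace ℝ E]
    (k : ℕ) (f : E → ℝ) (p : E) : Prop :=
  ∀ g : E → ℝ, IsSmoothGerm g p → SameJet k f g p → GermDiffeomorphic f g p

noncomputable section

/-- Iterated partial derivatives: `pd [i, j, k] f` is `∂³f / ∂xᵢ∂xⱼ∂xₖ`. -/
def pd {n : ℕ} : List (Fin n) → ((Fin n → ℝ) → ℝ) → (Fin n → ℝ) → ℝ
  | [], f => f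
  | i :: l, f => fun p => fderiv ℝ (pd l f) p (Pi.single i 1)

/-! In four variables the coordinates `x, y, z, w` have the indices `0, 1, 2, 3`. -/

/-- The Hessian matrix `H` of `V` at `P`. -/
def hessian (V : (Fin 4 → ℝ) → ℝ) (P : Fin 4 → ℝ) : Matrix (Fin 4) (Fin 4) ℝ :=
  Matrix.of fun i j => pd [i, j] V P

/-- The upper left block `H₁` of the Hessian (variables `x, y`). -/
def H₁ (V : (Fin 4 → ℝ) → ℝ) (P : Fin 4 → ℝ) : Matrix (Fin 2) (Fin 2) ℝ :=
  (hessian V P).submatrix ![0, 1] ![0, 1]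

/-- The lower right block `H₂` of the Hessian (variables `z, w`). -/
def H₂ (V : (Fin 4 → ℝ) → ℝ) (P : Fin 4 → ℝ) : Matrix (Fin 2) (Fin 2) ℝ :=
  (hessian V P).submatrix ![2, 3] ![2, 3]

/-- The 3 by 3 upper left submatrix of the Hessian (variables `x, y, z`). -/
def matM (V : (Fin 4 → ℝ) → ℝ) (P : Fin 4 → ℝ) : Matrix (Fin 3) (Fin 3) ℝ :=
  (hessian V P).submatrix ![0, 1, 2] ![0, 1, 2]

/-- The `(i, j)` minor of `matM`. -/
def minorM (V : (Fin 4 → ℝ) → ℝ) (P : Fin 4 → ℝ) (i j : Fin 3) : ℝ :=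
  ((matM V P).submatrix i.succAbove j.succAbove).det

/-- `α = V_zw / V_zz`. -/
def α (V : (Fin 4 → ℝ) → ℝ) (P : Fin 4 → ℝ) : ℝ := pd [2, 3] V P / pd [2, 2] V P

def D2 (V : (Fin 4 → ℝ) → ℝ) (P : Fin 4 → ℝ) : ℝ :=
  α V P ^ 2 * pd [2, 2] V P - 2 * α V P * pd [2, 3] V P + pd [3, 3] V P

def D3 (V : (Fin 4 → ℝ) → ℝ) (P : Fin 4 → ℝ) : ℝ :=
  α V P ^ 3 * pd [2, 2, 2] V P - 3 * α V P ^ 2 * pd [2, 2, 3] V P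
    + 3 * α V P * pd [2, 3, 3] V P - pd [3, 3, 3] V P

def D4 (V : (Fin 4 → ℝ) → ℝ) (P : Fin 4 → ℝ) : ℝ :=
  α V P ^ 4 * pd [2, 2, 2, 2] V P - 4 * α V P ^ 3 * pd [2, 2, 2, 3] V P
    + 6 * α V P ^ 2 * pd [2, 2, 3, 3] V P - 4 * α V P * pd [2, 3, 3, 3] V P
    + pd [3, 3, 3, 3] V P

/-- `κ V P 0`, `κ V P 1`, `κ V P 2` are `κ₁, κ₂, κ₃`:
`α² V_{izz} - 2 α V_{izw} + V_{iww}` with `i` equal to `x`, `y`, `z`. -/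
def κ (V : (Fin 4 → ℝ) → ℝ) (P : Fin 4 → ℝ) (i : Fin 3) : ℝ :=
  α V P ^ 2 * pd [i.castSucc, 2, 2] V P - 2 * α V P * pd [i.castSucc, 2, 3] V P
    + pd [i.castSucc, 3, 3] V P

/-- The left side of the fourth order condition for a potential without symmetry. -/
def generalQuartic (V : (Fin 4 → ℝ) → ℝ) (P : Fin 4 → ℝ) : ℝ :=
  (matM V P).det * D4 V P
    - 3 * ∑ i : Fin 3, ∑ j : Fin 3,
        (-1) ^ ((i : ℕ) + (j : ℕ)) * minorM V P i j * κ V P i * κ V P j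

/-- The left side of the fourth order condition for a symmetric potential. -/
def reducedQuartic (V : (Fin 4 → ℝ) → ℝ) (P : Fin 4 → ℝ) : ℝ :=
  (pd [0, 0] V P * pd [1, 1] V P - pd [0, 1] V P ^ 2) * D4 V P
    - 3 * (κ V P 0 ^ 2 * pd [1, 1] V P - 2 * κ V P 0 * κ V P 1 * pd [0, 1] V P
      + κ V P 1 ^ 2 * pd [0, 0] V P)

/-- The potential `½ y² + ½ z² + g(x, w)`. -/
def twoParameter (g : (Fin 2 → ℝ) → ℝ) : (Fin 4 → ℝ) → ℝ :=
  fun p => 1 / 2 * p 1 ^ 2 + 1 / 2 * p 2 ^ 2 + g ![p 0, p 3]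

/-- The potential `½ x² + ½ y² + ½ z² + f(w)`. -/
def oneParameter (f : ℝ → ℝ) : (Fin 4 → ℝ) → ℝ :=
  fun p => 1 / 2 * p 0 ^ 2 + 1 / 2 * p 1 ^ 2 + 1 / 2 * p 2 ^ 2 + f (p 3)

end

end Tricritical

/-! Take linear coordinates `(u, t)` at `P`, with `u` along `x, y, z` and `t` along the soft
direction `e = (0, 0, -α, 1)`. The value of `α` and the parity of `V` make `e` orthogonal to the
`u`-space for the Hessian, and the Hessian is nondegenerate on the `u`-space because `det H₁` and
`V_zz` do not vanish. By the splitting lemma (`exists_splitting`), `V` becomes `φ(t) + ½ β(u, u)` in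
smooth coordinates, so determinacy depends only on the order of vanishing of `φ - φ(0)`.

If `φ = c + a t^k + O(t^(k+1))` with `a ≠ 0`, a change of the variable `t` makes it exactly `c + a
t^k`. A germ with the same `k`-jet has the same `β`, `c`, `a`, hence the same normal form, and `V`
is `k`-determined. If `φ = c + O(t^(k+1))`, then `V` shares its `k`-jet with `c + ½ β(u, u) + ε
t^(k+1)` for every `ε`. The origin is a non-isolated critical point for `ε = 0` and an isolated one
for `ε = 1`, so these two germs cannot both be diffeomorphic to `V`.

The function `φ` is the critical value `F(h(t), t)` on the curve `h` of critical points of `F(·,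
t)`. It need not be computed exactly: if the `u`-derivative of `F` is `O(t^m)` along a curve `γ`,
then `γ - h = O(t^m)`, and stationarity gives `φ(t) - F(γ(t), t) = O(t^(2m))`. This turns
determinacy into the curve criteria `isDetermined_of_curve` and `not_isDetermined_of_curve`.

Two trial curves suffice. The line `u = 0` has `m = 2` and gives `φ` modulo `t^4`: the quadratic
coefficient is `D2 / 2`, and the cubic one is zero by parity. The parabola `u = t² b` with `H₁ b =
-κ / 2` has `m = 3`. If `D2 = 0`, it gives the quartic coefficient `reducedQuartic / (24 det H₁)`.
The rest is algebra: `V_zz · D2 = det H₂`, `D3 = 0` by parity, and `generalQuartic = V_zz ·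
reducedQuartic`. The order parameter families are specialisations, the second being the first with
`g = ½ x² + f(w)`. -/

namespace Tricritical

universe u

/-! ### Smooth germs, global representatives, and the smooth inverse function theorem. -/

section Germs

variable {E F G : Type*} [NormedAddCommGroup E] [NormedSpace ℝ E]
  [NormedAddCommGroup F] [NormedSpace ℝ F] [NormedAddCommGroup G] [NormedSpace ℝ G]

lemma IsSmoothGerm.contDiffAt {f : E → F} {p : E} (h : IsSmoothGerm f p) : ContDiffAt ℝ ∞ f p :=
  h.self_of_nhds

lemma IsSmoothGerm.continuousAt {f : E → F} {p : E} (h : IsSmoothGerm f p) : ContinuousAt f p :=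
  h.contDiffAt.continuousAt

lemma _root_.ContDiff.isSmoothGerm {f : E → F} (h : ContDiff ℝ ∞ f) (p : E) : IsSmoothGerm f p :=
  Eventually.of_forall fun _ => h.contDiffAt

lemma IsSmoothGerm.comp {f : E → F} {g : F → G} {p : E} (hg : IsSmoothGerm g (f p))
    (hf : IsSmoothGerm f p) : IsSmoothGerm (g ∘ f) p := by
  filter_upwards [hf, hf.continuousAt.eventually hg] with x hx hgx
  exact hgx.comp x hx

lemma IsSmoothGerm.congr {f g : E → F} {p : E} (hf : IsSmoothGerm f p) (h : g =ᶠ[𝓝 p] f) :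
    IsSmoothGerm g p := by
  filter_upwards [hf, h.eventuallyEq_nhds] with x hx hgx
  exact hx.congr_of_eventuallyEq hgx

/-- Cutting off with a bump function supported where `f` is smooth gives a global representative.
All the analysis below can then be done with globally smooth functions. -/
lemma IsSmoothGerm.exists_contDiff [FiniteDimensional ℝ E] {f : E → F} {p : E}
    (hf : IsSmoothGerm f p) : ∃ g : E → F, ContDiff ℝ ∞ g ∧ g =ᶠ[𝓝 p] f := by
  obtain ⟨s, hs, hso, hps⟩ := eventually_nhds_iff.1 hf
  obtain ⟨r, hr, hrs⟩ := Metric.isOpen_iff.1 hso p hps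
  let χ : ContDiffBump p := ⟨r / 4, r / 2, by positivity, by linarith⟩
  refine ⟨fun x => χ x • f x, ?_, ?_⟩
  · rw [contDiff_iff_contDiffAt]
    intro x
    by_cases hx : x ∈ Metric.ball p r
    · exact χ.contDiffAt.smul (hs x (hrs hx))
    · have hx' : x ∈ (Metric.closedBall p (r / 2))ᶜ := by
        simp only [Metric.mem_ball, not_lt, Set.mem_compl_iff, Metric.mem_closedBall, not_le] at hx ⊢
        linarith
      have : (fun x => χ x • f x) =ᶠ[𝓝 x] fun _ => 0 := by
        filter_upwards [Metric.isClosed_closedBall.isOpen_compl.mem_nhds hx'] with y hy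
        have : χ y = 0 := χ.zero_of_le_dist (by
          simp only [Set.mem_compl_iff, Metric.mem_closedBall, not_le] at hy
          exact hy.le)
        simp [this]
      exact contDiffAt_const.congr_of_eventuallyEq this
  · filter_upwards [χ.eventuallyEq_one] with x hx
    simp [hx]

/-- The inverse has to be smooth on a whole neighbourhood, not only at the image point. The chart of
the inverse function theorem is therefore shrunk to points where `f` is smooth and its derivative is
invertible, which is an open condition. -/
lemma IsSmoothGerm.isLocalDiffeomorphAt [CompleteSpace E] {f : E → F} {p : E}
    (hf : IsSmoothGerm f p) {f' : E ≃L[ℝ] F} (hf' : HasFDerivAt f (f' : E →L[ℝ] F) p) :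
    IsLocalDiffeomorphAt 𝓘(ℝ, E) 𝓘(ℝ, F) ∞ f p := by
  have hinv : ∀ᶠ x in 𝓝 p, fderiv ℝ f x ∈ Set.range ((↑) : (E ≃L[ℝ] F) → E →L[ℝ] F) := by
    have hc : ContinuousAt (fderiv ℝ f) p :=
      (hf.contDiffAt.fderiv_right (m := 0) (by norm_num)).continuousAt
    refine hc.eventually (ContinuousLinearEquiv.isOpen.mem_nhds ?_)
    rw [hf'.fderiv]
    exact ⟨f', rfl⟩
  obtain ⟨s, hs, hso, hps⟩ := eventually_nhds_iff.1 (hf.and hinv)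
  let e := (hf.contDiffAt.toOpenPartialHomeomorph f hf' (by simp)).restrOpen s hso
  have hes : e.source ⊆ s := fun x hx => hx.2
  refine ⟨⟨e.toPartialEquiv, e.open_source, e.open_target, ?_, ?_⟩, ?_, ?_⟩
  · intro x hx
    exact (hs x (hes hx)).1.contMDiffAt.contMDiffWithinAt
  · intro y hy
    refine ContMDiffAt.contMDiffWithinAt (ContDiffAt.contMDiffAt ?_)
    have hx := e.map_target hy
    obtain ⟨A, hA⟩ := (hs _ (hes hx)).2
    refine e.contDiffAt_symm (f₀' := A) hy ?_ (hs _ (hes hx)).1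
    rw [hA]
    exact ((hs _ (hes hx)).1.differentiableAt (by simp)).hasFDerivAt
  · exact ⟨hf.contDiffAt.mem_toOpenPartialHomeomorph_source hf' (by simp), hps⟩
  · exact fun x _ => rfl

lemma _root_.IsLocalDiffeomorphAt.exists_germ_inverse {f : E → F} {p : E}
    (h : IsLocalDiffeomorphAt 𝓘(ℝ, E) 𝓘(ℝ, F) ∞ f p) :
    IsSmoothGerm f p ∧ ∃ g : F → E, IsLocalDiffeomorphAt 𝓘(ℝ, F) 𝓘(ℝ, E) ∞ g (f p) ∧
      IsSmoothGerm g (f p) ∧ g (f p) = p ∧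
      (∀ᶠ x in 𝓝 p, g (f x) = x) ∧ ∀ᶠ y in 𝓝 (f p), f (g y) = y := by
  refine ⟨?_, h.localInverse, h.localInverse_isLocalDiffeomorphAt, ?_,
    h.localInverse_eventuallyEq_left.self_of_nhds, h.localInverse_eventuallyEq_left,
    h.localInverse_eventuallyEq_right⟩
  · obtain ⟨Φ, hx, heq⟩ := h
    filter_upwards [Φ.open_source.mem_nhds hx] with x hx'
    exact ((Φ.contMDiffOn_toFun.congr heq).contMDiffAt (Φ.open_source.mem_nhds hx')).contDiffAt
  · filter_upwards [h.localInverse_open_source.mem_nhds h.localInverse_mem_source] with y hy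
    exact (h.localInverse_contMDiffOn.contMDiffAt (h.localInverse_open_source.mem_nhds hy)).contDiffAt

end Germs

/-! ### Smoothness of integrals depending on a parameter. -/

section ParametricIntegral

variable {E : Type u} [NormedAddCommGroup E] [NormedSpace ℝ E] [FiniteDimensional ℝ E]

lemma hasFDerivAt_intervalIntegral_of_contDiff {F : Type*} [NormedAddCommGroup F] [NormedSpace ℝ F]
    {f : E × ℝ → F} (hf : ContDiff ℝ 1 f) (x₀ : E) :
    HasFDerivAt (fun x => ∫ s in (0 : ℝ)..1, f (x, s))
      (∫ s in (0 : ℝ)..1, (fderiv ℝ f (x₀, s)).comp (ContinuousLinearMap.inl ℝ E ℝ)) x₀ := by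
  have hcf : Continuous f := hf.continuous
  have hcf' : Continuous fun q : E × ℝ => (fderiv ℝ f q).comp (ContinuousLinearMap.inl ℝ E ℝ) :=
    (hf.continuous_fderiv (by simp)).clm_comp continuous_const
  have hK : IsCompact (Metric.closedBall x₀ 1 ×ˢ Set.Icc (0 : ℝ) 1) :=
    (isCompact_closedBall x₀ 1).prod isCompact_Icc
  -- Compactness of the closed ball times `[0, 1]` yields the constant bound used for dominated
  -- convergence.
  obtain ⟨C, hC⟩ := hK.exists_bound_of_continuousOn hcf'.continuousOn
  refine intervalIntegral.hasFDerivAt_integral_of_dominated_of_fderiv_le (𝕜 := ℝ)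
    (F := fun x s => f (x, s))
    (F' := fun x s => (fderiv ℝ f (x, s)).comp (ContinuousLinearMap.inl ℝ E ℝ))
    (bound := fun _ => C) (Metric.closedBall_mem_nhds x₀ one_pos) ?_ ?_ ?_ ?_ ?_ ?_
  · exact Eventually.of_forall fun x => (by fun_prop : Continuous fun s => f (x, s)).aestronglyMeasurable
  · exact (by fun_prop : Continuous fun s => f (x₀, s)).intervalIntegrable _ _
  · exact (hcf'.comp (by fun_prop : Continuous fun s : ℝ => (x₀, s))).aestronglyMeasurable
  · refine Eventually.of_forall fun s hs x hx => hC (x, s) ⟨hx, ?_⟩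
    rw [Set.uIoc_of_le zero_le_one] at hs
    exact ⟨hs.1.le, hs.2⟩
  · exact intervalIntegrable_const
  · refine Eventually.of_forall fun s _ x _ => ?_
    have h1 : HasFDerivAt f (fderiv ℝ f (x, s)) (x, s) :=
      (hf.differentiable (by simp) _).hasFDerivAt
    exact h1.comp x (hasFDerivAt_prodMk_left x s)

/-- Induction on the order of smoothness. The target space is quantified inside the induction, since
each differentiation replaces `F` by `E →L[ℝ] F`; the common universe keeps this space in the range
of the induction hypothesis. -/
lemma contDiff_intervalIntegral_nat (n : ℕ) : ∀ {F : Type u} [NormedAddCommGroup F]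
    [NormedSpace ℝ F] {f : E × ℝ → F}, ContDiff ℝ ∞ f →
    ContDiff ℝ n (fun x => ∫ s in (0 : ℝ)..1, f (x, s)) := by
  induction n with
  | zero =>
    intro F _ _ f hf
    have := hf.continuous
    exact contDiff_zero.2 (intervalIntegral.continuous_parametric_intervalIntegral_of_continuous'
      (by simpa [Function.uncurry_def] using this) 0 1)
  | succ n ih =>
    intro F _ _ f hf
    have hd := hasFDerivAt_intervalIntegral_of_contDiff (hf.of_le (by exact_mod_cast le_top))
    rw [show ((n + 1 : ℕ) : WithTop ℕ∞) = n + 1 by simp, contDiff_succ_iff_fderiv]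
    refine ⟨fun x => (hd x).differentiableAt, by simp, ?_⟩
    rw [show fderiv ℝ (fun x => ∫ s in (0 : ℝ)..1, f (x, s)) = _ from
      funext fun x => (hd x).fderiv]
    exact ih ((hf.fderiv_right (m := ∞) (by simp)).clm_comp contDiff_const)

lemma contDiff_intervalIntegral {F : Type u} [NormedAddCommGroup F]
    [NormedSpace ℝ F] {f : E × ℝ → F} (hf : ContDiff ℝ ∞ f) :
    ContDiff ℝ ∞ (fun x => ∫ s in (0 : ℝ)..1, f (x, s)) :=
  contDiff_infty.2 fun n => contDiff_intervalIntegral_nat n hf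

end ParametricIntegral

/-! ### Taylor's formula with smooth remainder, and Hadamard division by powers of `t`. -/

section Taylor

/-- Integration by parts: `(1 - s) g' + g` is a primitive of `(1 - s) g''`. -/
lemma integral_one_sub_mul_eq {g g' g'' : ℝ → ℝ} (h : ∀ s, HasDerivAt g (g' s) s)
    (h' : ∀ s, HasDerivAt g' (g'' s) s) (hc : Continuous g'') :
    g 1 = g 0 + g' 0 + ∫ s in (0 : ℝ)..1, (1 - s) * g'' s := by
  have hd : ∀ s ∈ Set.uIcc (0 : ℝ) 1,
      HasDerivAt (fun s => (1 - s) * g' s + g s) ((1 - s) * g'' s) s := by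
    intro s _
    have := (((hasDerivAt_id s).const_sub 1).mul (h' s)).add (h s)
    refine this.congr_deriv ?_
    simp
  rw [intervalIntegral.integral_eq_sub_of_hasDerivAt hd
    ((by fun_prop : Continuous fun s => (1 - s) * g'' s).intervalIntegrable _ _)]
  ring

variable {U : Type u} [NormedAddCommGroup U] [NormedSpace ℝ U]

lemma clm_apply_intervalIntegral {W : Type*} [NormedAddCommGroup W] [NormedSpace ℝ W]
    [CompleteSpace W] (L : W →L[ℝ] ℝ) {f : ℝ → W} (hf : Continuous f) :
    L (∫ s in (0 : ℝ)..1, f s) = ∫ s in (0 : ℝ)..1, L (f s) :=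
  (L.intervalIntegral_comp_comm (hf.intervalIntegrable _ _)).symm

/-- The weighted mean `∫₀¹ (1 - s) f (s u, t) ds`. -/
noncomputable def radialMean {U : Type u} [NormedAddCommGroup U] [NormedSpace ℝ U]
    {W : Type u} [NormedAddCommGroup W] [NormedSpace ℝ W] (f : U × ℝ → W) (q : U × ℝ) : W :=
  ∫ s in (0 : ℝ)..1, (1 - s) • f (s • q.1, q.2)

section RadialMean

variable {U : Type u} [NormedAddCommGroup U] [NormedSpace ℝ U]
  {W : Type u} [NormedAddCommGroup W] [NormedSpace ℝ W] {f : U × ℝ → W}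

lemma contDiff_radialMean [FiniteDimensional ℝ U] (hf : ContDiff ℝ ∞ f) :
    ContDiff ℝ ∞ (radialMean f) := by
  have h : ContDiff ℝ ∞ fun x : (U × ℝ) × ℝ => (1 - x.2) • f (x.2 • x.1.1, x.1.2) :=
    ContDiff.smul (by fun_prop)
      (hf.comp (by fun_prop : ContDiff ℝ ∞ fun x : (U × ℝ) × ℝ => (x.2 • x.1.1, x.1.2)))
  exact contDiff_intervalIntegral h

lemma radialMean_zero_left [CompleteSpace W] (t : ℝ) :
    radialMean f (0, t) = (1 / 2 : ℝ) • f (0, t) := by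
  simp only [radialMean, smul_zero]
  rw [intervalIntegral.integral_smul_const, intervalIntegral.integral_comp_sub_left (fun x : ℝ => x)]
  norm_num

lemma clm_apply_radialMean [CompleteSpace W] (hf : Continuous f) (L : W →L[ℝ] ℝ) (q : U × ℝ) :
    L (radialMean f q) = ∫ s in (0 : ℝ)..1, (1 - s) * L (f (s • q.1, q.2)) := by
  have hc : Continuous fun s : ℝ => (1 - s) • f (s • q.1, q.2) := by fun_prop
  rw [radialMean, clm_apply_intervalIntegral L hc]
  simp

end RadialMean

/-- The second partial derivative in the direction of the first factor. -/
noncomputable def partialHessian (F : U × ℝ → ℝ) (q : U × ℝ) : U →L[ℝ] U →L[ℝ] ℝ :=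
  ((ContinuousLinearMap.compL ℝ U (U × ℝ) ℝ).flip (ContinuousLinearMap.inl ℝ U ℝ)).comp
    ((fderiv ℝ (fderiv ℝ F) q).comp (ContinuousLinearMap.inl ℝ U ℝ))

lemma partialHessian_apply (F : U × ℝ → ℝ) (q : U × ℝ) (u w : U) :
    partialHessian F q u w = fderiv ℝ (fderiv ℝ F) q (u, 0) (w, 0) := by
  simp [partialHessian]

lemma contDiff_partialHessian {F : U × ℝ → ℝ} (hF : ContDiff ℝ ∞ F) :
    ContDiff ℝ ∞ (partialHessian F) :=
  contDiff_const.clm_comp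
    (((hF.fderiv_right (m := ∞) (by simp)).fderiv_right (m := ∞) (by simp)).clm_comp contDiff_const)

lemma partialHessian_symm {F : U × ℝ → ℝ} (hF : ContDiff ℝ ∞ F) (q : U × ℝ) (u w : U) :
    partialHessian F q u w = partialHessian F q w u := by
  simp only [partialHessian_apply]
  exact (hF.contDiffAt.isSymmSndFDerivAt (by simp only [minSmoothness_of_isRCLikeNormedField]; exact WithTop.coe_le_coe.2 le_top)).eq _ _

lemma hasDerivAt_comp_smul_fst {W : Type*} [NormedAddCommGroup W] [NormedSpace ℝ W]
    {F : U × ℝ → W} (hF : Differentiable ℝ F) (v : U) (t s : ℝ) :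
    HasDerivAt (fun s : ℝ => F (s • v, t)) (fderiv ℝ F (s • v, t) (v, 0)) s := by
  have h1 : HasDerivAt (fun s : ℝ => (s • v, t)) (v, 0) s := by
    have := (((hasDerivAt_id s).smul_const v).prodMk (hasDerivAt_const s t))
    simpa using this
  exact (hF (s • v, t)).hasFDerivAt.comp_hasDerivAt s h1

/-- Taylor's formula of second order in the first factor, with smooth remainder. -/
lemma exists_smooth_taylor_two [FiniteDimensional ℝ U] {F : U × ℝ → ℝ} (hF : ContDiff ℝ ∞ F) :
    ∃ B : U × ℝ → U →L[ℝ] U →L[ℝ] ℝ, ContDiff ℝ ∞ B ∧ (∀ q u w, B q u w = B q w u) ∧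
      (∀ t, B (0, t) = (1 / 2 : ℝ) • partialHessian F (0, t)) ∧
      ∀ v t, F (v, t) = F (0, t) + fderiv ℝ F (0, t) (v, 0) + B (v, t) v v := by
  have hcont := (contDiff_partialHessian hF).continuous
  have happ : ∀ (q : U × ℝ) (u w : U), radialMean (partialHessian F) q u w =
      ∫ s in (0 : ℝ)..1, (1 - s) * partialHessian F (s • q.1, q.2) u w := by
    intro q u w
    let L₁ : (U →L[ℝ] ℝ) →L[ℝ] ℝ := ContinuousLinearMap.apply ℝ ℝ w
    let L₂ : (U →L[ℝ] U →L[ℝ] ℝ) →L[ℝ] (U →L[ℝ] ℝ) := ContinuousLinearMap.apply ℝ (U →L[ℝ] ℝ) u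
    exact clm_apply_radialMean hcont (L₁ ∘L L₂) q
  refine ⟨radialMean (partialHessian F), contDiff_radialMean (contDiff_partialHessian hF), ?_,
    fun t => radialMean_zero_left t, ?_⟩
  · intro q u w
    rw [happ, happ]
    simp_rw [partialHessian_symm hF _ u w]
  · intro v t
    rw [happ (v, t) v v]
    have hd := hF.differentiable (by simp)
    have hF' : ContDiff ℝ ∞ (fderiv ℝ F) := hF.fderiv_right (by simp)
    have hd' : Differentiable ℝ (fderiv ℝ F) := hF'.differentiable (by simp)
    have := integral_one_sub_mul_eq (g := fun s => F (s • v, t))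
      (g' := fun s => fderiv ℝ F (s • v, t) (v, 0))
      (g'' := fun s => partialHessian F (s • v, t) v v)
      (hasDerivAt_comp_smul_fst hd v t) (fun s => by
        rw [partialHessian_apply]
        have := (hasDerivAt_comp_smul_fst hd' v t s).clm_apply (hasDerivAt_const s (v, (0 : ℝ)))
        simpa using this) (by fun_prop)
    simpa using this

/-- Hadamard's lemma: the quotient is the mean of `f'` over the segment from `0` to `t`, which is
smooth also at `t = 0`. -/
lemma exists_smooth_div {f : ℝ → ℝ} (hf : ContDiff ℝ ∞ f) (h0 : f 0 = 0) :
    ∃ g : ℝ → ℝ, ContDiff ℝ ∞ g ∧ ∀ t, f t = t * g t := by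
  have hd : ContDiff ℝ ∞ (deriv f) := (contDiff_infty_iff_deriv.1 hf).2
  refine ⟨fun t => ∫ s in (0 : ℝ)..1, deriv f (s * t), ?_, fun t => ?_⟩
  · exact contDiff_intervalIntegral (f := fun x : ℝ × ℝ => deriv f (x.2 * x.1))
      (hd.comp (by fun_prop))
  · have hder : ∀ s ∈ Set.uIcc (0 : ℝ) 1,
        HasDerivAt (fun s => f (s * t)) (t * deriv f (s * t)) s := by
      intro s _
      have h1 : HasDerivAt f (deriv f (s * t)) (s * t) :=
        (hf.differentiable (by simp) _).hasDerivAt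
      have := h1.comp s ((hasDerivAt_id s).mul_const t)
      refine this.congr_deriv (by ring)
    have hc : Continuous fun s => t * deriv f (s * t) := by
      have := hd.continuous
      fun_prop
    rw [← intervalIntegral.integral_const_mul,
      intervalIntegral.integral_eq_sub_of_hasDerivAt hder (hc.intervalIntegrable _ _)]
    simp [h0]

lemma exists_smooth_div_pow (n : ℕ) : ∀ {f : ℝ → ℝ}, ContDiff ℝ ∞ f →
    f =O[𝓝[≠] 0] (fun t => t ^ n) → ∃ g : ℝ → ℝ, ContDiff ℝ ∞ g ∧ ∀ t, f t = t ^ n * g t := by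
  induction n with
  | zero => exact fun {f} hf _ => ⟨f, hf, by simp⟩
  | succ n ih =>
    intro f hf hO
    have h0 : f 0 = 0 := by
      have h1 : Tendsto f (𝓝[≠] 0) (𝓝 0) := by
        refine hO.trans_tendsto (tendsto_nhdsWithin_of_tendsto_nhds ?_)
        exact (continuous_pow (n + 1)).tendsto' 0 0 (by simp)
      have h2 : Tendsto f (𝓝[≠] 0) (𝓝 (f 0)) :=
        tendsto_nhdsWithin_of_tendsto_nhds hf.continuous.continuousAt
      exact tendsto_nhds_unique h2 h1
    obtain ⟨g, hg, hfg⟩ := exists_smooth_div hf h0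
    -- One factor `|t|` is cancelled, which is legitimate only off the origin; this is why the order
    -- condition is on the punctured neighbourhood.
    have hgO : g =O[𝓝[≠] 0] fun t => t ^ n := by
      obtain ⟨C, hC⟩ := hO.bound
      refine Asymptotics.IsBigO.of_bound C ?_
      filter_upwards [hC, self_mem_nhdsWithin] with t ht ht0
      have ht0' : 0 < ‖t‖ := norm_pos_iff.2 ht0
      rw [hfg, pow_succ, norm_mul, norm_mul] at ht
      nlinarith
    obtain ⟨k, hk, hgk⟩ := ih hg hgO
    exact ⟨k, hk, fun t => by rw [hfg, hgk]; ring⟩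

end Taylor

/-! ### Square roots of operators near a given isomorphism. -/

section SquareRoot

variable {U Y : Type*} [NormedAddCommGroup U] [NormedSpace ℝ U] [NormedAddCommGroup Y]
  [NormedSpace ℝ Y] [CompleteSpace Y]

/-- The map `S ↦ S β⁻¹ S` fixes `β` and has derivative `H ↦ 2 H` there, so the inverse function
theorem provides a smooth local inverse `r`. This is the root needed in the Morse lemma with
parameters. -/
lemma exists_smooth_sqrt (β : U ≃L[ℝ] Y) :
    ∃ r : (U →L[ℝ] Y) → (U →L[ℝ] Y), IsSmoothGerm r (β : U →L[ℝ] Y) ∧ r β = β ∧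
      (∀ᶠ S in 𝓝 (β : U →L[ℝ] Y), r ((S ∘L (β.symm : Y →L[ℝ] U)) ∘L S) = S) ∧
      ∀ᶠ T in 𝓝 (β : U →L[ℝ] Y), (r T ∘L (β.symm : Y →L[ℝ] U)) ∘L r T = T := by
  let N : (U →L[ℝ] Y) → (U →L[ℝ] Y) := fun S => (S ∘L (β.symm : Y →L[ℝ] U)) ∘L S
  have hN : ContDiff ℝ ∞ N := (contDiff_id.clm_comp contDiff_const).clm_comp contDiff_id
  have hNβ : N β = β := by ext u; simp [N]
  let A : (U →L[ℝ] Y) ≃L[ℝ] (U →L[ℝ] Y) :=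
    ContinuousLinearEquiv.smulLeft (Units.mk0 (2 : ℝ) two_ne_zero)
  have hd : HasFDerivAt N (A : (U →L[ℝ] Y) →L[ℝ] (U →L[ℝ] Y)) (β : U →L[ℝ] Y) := by
    have h1 := (((hasFDerivAt_id (𝕜 := ℝ) (β : U →L[ℝ] Y)).clm_comp
      (hasFDerivAt_const (β.symm : Y →L[ℝ] U) (β : U →L[ℝ] Y))).clm_comp
      (hasFDerivAt_id (𝕜 := ℝ) (β : U →L[ℝ] Y)))
    refine h1.congr_fderiv ?_
    ext H u
    simp [A, two_smul]
  have := (IsSmoothGerm.isLocalDiffeomorphAt (hN.isSmoothGerm _) hd).exists_germ_inverse.2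
  obtain ⟨r, -, hr, hrβ, hl, hri⟩ := this
  rw [hNβ] at hr hrβ hri
  exact ⟨r, hr, hrβ, hl, hri⟩

end SquareRoot

/-! ### The curve of critical points in the nondegenerate directions. -/

section Splitting

variable {U : Type u} [NormedAddCommGroup U] [NormedSpace ℝ U]

/-- The partial derivative in the direction of the first factor. -/
noncomputable def partialDeriv (F : U × ℝ → ℝ) (q : U × ℝ) : U →L[ℝ] ℝ :=
  (fderiv ℝ F q).comp (ContinuousLinearMap.inl ℝ U ℝ)

lemma contDiff_partialDeriv {F : U × ℝ → ℝ} (hF : ContDiff ℝ ∞ F) :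
    ContDiff ℝ ∞ (partialDeriv F) :=
  (hF.fderiv_right (m := ∞) (by simp)).clm_comp contDiff_const

lemma partialDeriv_apply (F : U × ℝ → ℝ) (q : U × ℝ) (u : U) :
    partialDeriv F q u = fderiv ℝ F q (u, 0) := by
  simp [partialDeriv]

lemma fderiv_partialDeriv_apply {F : U × ℝ → ℝ} (hF : ContDiff ℝ ∞ F) (q v : U × ℝ) (w : U) :
    fderiv ℝ (partialDeriv F) q v w = fderiv ℝ (fderiv ℝ F) q v (w, 0) := by
  have hd : DifferentiableAt ℝ (fderiv ℝ F) q :=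
    (hF.fderiv_right (m := ∞) (by simp)).differentiable (by simp) q
  have := (hd.hasFDerivAt.clm_comp
    (hasFDerivAt_const (ContinuousLinearMap.inl ℝ U ℝ) q)).fderiv
  rw [show fderiv ℝ (partialDeriv F) q = _ from this]
  simp

/-- A shear in the direction of the first factor. -/
noncomputable def shear {Y : Type*} [NormedAddCommGroup Y] [NormedSpace ℝ Y] (β : U ≃L[ℝ] Y)
    (m : Y) : (U × ℝ) ≃L[ℝ] (Y × ℝ) :=
  ContinuousLinearEquiv.equivOfInverse
    (((β : U →L[ℝ] Y) ∘L ContinuousLinearMap.fst ℝ U ℝ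
      + (ContinuousLinearMap.snd ℝ U ℝ).smulRight m).prod (ContinuousLinearMap.snd ℝ U ℝ))
    (((β.symm : Y →L[ℝ] U) ∘L (ContinuousLinearMap.fst ℝ Y ℝ
      - (ContinuousLinearMap.snd ℝ Y ℝ).smulRight m)).prod (ContinuousLinearMap.snd ℝ Y ℝ))
    (fun q => by ext <;> simp) (fun q => by ext <;> simp)

lemma shear_apply {Y : Type*} [NormedAddCommGroup Y] [NormedSpace ℝ Y] (β : U ≃L[ℝ] Y)
    (m : Y) (q : U × ℝ) : shear β m q = (β q.1 + q.2 • m, q.2) := by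
  simp [shear]

/-- The critical points of the restrictions `F (·, t)` form a smooth curve `h`, and the partial
derivative of `F` controls the distance from this curve. -/
lemma exists_critical_curve [FiniteDimensional ℝ U] {F : U × ℝ → ℝ} (hF : ContDiff ℝ ∞ F)
    (h0 : partialDeriv F 0 = 0) (β : U ≃L[ℝ] (U →L[ℝ] ℝ))
    (hβ : (β : U →L[ℝ] U →L[ℝ] ℝ) = partialHessian F 0) :
    ∃ h : ℝ → U, ContDiff ℝ ∞ h ∧ h 0 = 0 ∧ (∀ᶠ t in 𝓝 0, partialDeriv F (h t, t) = 0) ∧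
      ∃ K : ℝ, ∀ᶠ q : U × ℝ in 𝓝 0, ‖q.1 - h q.2‖ ≤ K * ‖partialDeriv F q‖ := by
  -- The derivative of `Ψ` at `0` is a shear over `β`, hence invertible. The critical curve is the
  -- preimage of `{0} × ℝ` under `Ψ`.
  let Ψ : U × ℝ → (U →L[ℝ] ℝ) × ℝ := fun q => (partialDeriv F q, q.2)
  have hΨ : ContDiff ℝ ∞ Ψ := (contDiff_partialDeriv hF).prodMk contDiff_snd
  have hΨ0 : Ψ 0 = 0 := by simp [Ψ, h0]
  have hd : HasFDerivAt Ψ (shear β (fderiv ℝ (partialDeriv F) 0 (0, 1)) :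
      U × ℝ →L[ℝ] (U →L[ℝ] ℝ) × ℝ) 0 := by
    have h1 := ((contDiff_partialDeriv hF).differentiable (by simp) 0).hasFDerivAt.prodMk
      (hasFDerivAt_snd (𝕜 := ℝ) (p := (0 : U × ℝ)))
    refine h1.congr_fderiv ?_
    refine ContinuousLinearMap.ext fun q => ?_
    have e1 : fderiv ℝ (partialDeriv F) 0 (q.1, 0) = β q.1 := by
      ext w
      rw [fderiv_partialDeriv_apply hF, ← partialHessian_apply, ← hβ]
      rfl
    have e2 : q = (q.1, 0) + q.2 • ((0 : U), (1 : ℝ)) := by ext <;> simp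
    have e3 : fderiv ℝ (partialDeriv F) 0 q =
        β q.1 + q.2 • fderiv ℝ (partialDeriv F) 0 (0, 1) := by
      conv_lhs => rw [e2]
      rw [map_add, map_smul, e1]
    simp [shear_apply, e3]
  obtain ⟨g, -, hg, hg0, hl, hr⟩ :=
    (IsSmoothGerm.isLocalDiffeomorphAt (hΨ.isSmoothGerm _) hd).exists_germ_inverse.2
  rw [hΨ0] at hg hg0 hr
  have hcurve : IsSmoothGerm (fun t : ℝ => (g (0, t)).1) 0 := by
    have h1 : IsSmoothGerm (fun t : ℝ => ((0 : U →L[ℝ] ℝ), t)) 0 :=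
      (contDiff_const.prodMk contDiff_id).isSmoothGerm 0
    have h2 : IsSmoothGerm (fun q : U × ℝ => q.1) (g (0, 0)) := contDiff_fst.isSmoothGerm _
    have h3 : IsSmoothGerm (fun t : ℝ => g (0, t)) 0 :=
      IsSmoothGerm.comp (f := fun t : ℝ => ((0 : U →L[ℝ] ℝ), t)) hg h1
    exact IsSmoothGerm.comp (f := fun t : ℝ => g (0, t)) h2 h3
  obtain ⟨h, hh, hhg⟩ := hcurve.exists_contDiff
  have hci : Tendsto (fun t : ℝ => ((0 : U →L[ℝ] ℝ), t)) (𝓝 0) (𝓝 0) :=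
    (by fun_prop : Continuous fun t : ℝ => ((0 : U →L[ℝ] ℝ), t)).tendsto' _ _ rfl
  refine ⟨h, hh, ?_, ?_, ?_⟩
  · rw [hhg.self_of_nhds]
    exact congrArg Prod.fst hg0
  · filter_upwards [hhg, hci.eventually hr] with t ht hrt
    have h2 : (g (0, t)).2 = t := congrArg Prod.snd hrt
    have h1 : partialDeriv F (g (0, t)) = 0 := congrArg Prod.fst hrt
    rw [ht]
    nth_rewrite 2 [← h2]
    exact h1
  -- The distance estimate is the Lipschitz bound for the local inverse of `Ψ` between `Ψ q` and
  -- `(0, q.2)`, which differ only by the partial derivative at `q`.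
  · obtain ⟨K, s, hs, hK⟩ := (hg.contDiffAt.of_le (by exact_mod_cast le_top) :
      ContDiffAt ℝ 1 g 0).exists_lipschitzOnWith
    have hΨc : Tendsto Ψ (𝓝 0) (𝓝 0) := hΨ.continuous.tendsto' _ _ hΨ0
    have hsnd : Tendsto (fun q : U × ℝ => q.2) (𝓝 0) (𝓝 0) := continuous_snd.tendsto' _ _ rfl
    refine ⟨K, ?_⟩
    filter_upwards [hl, hΨc.eventually hs, hsnd.eventually (hci.eventually hs),
      hsnd.eventually hhg] with q hq hq1 hq2 hq3
    have h1 := hK.norm_sub_le hq1 hq2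
    rw [hq] at h1
    rw [hq3]
    calc ‖q.1 - (g (0, q.2)).1‖ = ‖(q - g (0, q.2)).1‖ := rfl
      _ ≤ ‖q - g (0, q.2)‖ := norm_fst_le _
      _ ≤ K * ‖Ψ q - (0, q.2)‖ := h1
      _ = K * ‖partialDeriv F q‖ := by simp [Ψ, Prod.norm_def]

end Splitting

/-! ### The splitting lemma: a Morse lemma with one parameter. -/

section Splitting

variable {U : Type u} [NormedAddCommGroup U] [NormedSpace ℝ U]

/-- For symmetric `T`, the transpose of the root of `T` is again a root of `T` close to `β`, so
local uniqueness of the root forces it to equal the root itself. -/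
lemma eventually_symm_sqrt {β : U ≃L[ℝ] (U →L[ℝ] ℝ)} (hs : ∀ u w, β u w = β w u)
    {r : (U →L[ℝ] U →L[ℝ] ℝ) → (U →L[ℝ] U →L[ℝ] ℝ)}
    (hc : ContinuousAt r (β : U →L[ℝ] U →L[ℝ] ℝ)) (hrβ : r β = β)
    (hl : ∀ᶠ S in 𝓝 (β : U →L[ℝ] U →L[ℝ] ℝ),
      r ((S ∘L (β.symm : (U →L[ℝ] ℝ) →L[ℝ] U)) ∘L S) = S)
    (hr : ∀ᶠ T in 𝓝 (β : U →L[ℝ] U →L[ℝ] ℝ),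
      (r T ∘L (β.symm : (U →L[ℝ] ℝ) →L[ℝ] U)) ∘L r T = T) :
    ∀ᶠ T in 𝓝 (β : U →L[ℝ] U →L[ℝ] ℝ), (∀ u w, T u w = T w u) →
      ∀ u w, r T u w = r T w u := by
  have hfl : Tendsto (fun T => (r T).flip) (𝓝 (β : U →L[ℝ] U →L[ℝ] ℝ))
      (𝓝 (β : U →L[ℝ] U →L[ℝ] ℝ)) := by
    have h1 : Continuous fun S : U →L[ℝ] U →L[ℝ] ℝ => S.flip :=
      (ContinuousLinearMap.flipₗᵢ ℝ U U ℝ).continuous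
    have h2 : (β : U →L[ℝ] U →L[ℝ] ℝ).flip = β := by
      ext u w
      exact hs w u
    have h3 := h1.continuousAt.tendsto.comp hc.tendsto
    rw [hrβ, h2] at h3
    exact h3
  filter_upwards [hr, hfl.eventually hl] with T hT hT' hsymm u w
  have hswap : ∀ a b : U →L[ℝ] ℝ, a (β.symm b) = b (β.symm a) := by
    intro a b
    have := hs (β.symm a) (β.symm b)
    simpa using this
  have hT2 : ∀ u w, r T (β.symm (r T u)) w = T u w := fun u w => by
    conv_rhs => rw [← hT]
    rfl
  have key : (((r T).flip ∘L (β.symm : (U →L[ℝ] ℝ) →L[ℝ] U)) ∘L (r T).flip) = T := by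
    ext u w
    change r T w (β.symm ((r T).flip u)) = T u w
    rw [hswap, hsymm u w, ← hT2]
    rfl
  rw [key] at hT'
  conv_lhs => rw [hT']
  rfl

/-- The splitting lemma: a function whose restriction to the first factor has a nondegenerate
critical point is, in suitable coordinates, the sum of a quadratic form and of a function `φ` of the
second factor. The value of `φ` is approximated along curves of almost critical points. -/
theorem exists_splitting [FiniteDimensional ℝ U] {F : U × ℝ → ℝ} (hF : ContDiff ℝ ∞ F)
    (h0 : partialDeriv F 0 = 0) (β : U ≃L[ℝ] (U →L[ℝ] ℝ))
    (hβ : (β : U →L[ℝ] U →L[ℝ] ℝ) = partialHessian F 0) :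
    ∃ (Θ : U × ℝ → U × ℝ) (φ : ℝ → ℝ),
      IsLocalDiffeomorphAt 𝓘(ℝ, U × ℝ) 𝓘(ℝ, U × ℝ) ∞ Θ 0 ∧ Θ 0 = 0 ∧ ContDiff ℝ ∞ φ ∧
      (∀ᶠ q in 𝓝 0, F q = φ (Θ q).2 + 1 / 2 * β (Θ q).1 (Θ q).1) ∧
      ∀ (γ : ℝ → U) (m : ℕ), Tendsto γ (𝓝 0) (𝓝 0) →
        (fun t => partialDeriv F (γ t, t)) =O[𝓝 0] (fun t => t ^ m) →
        (fun t => φ t - F (γ t, t)) =O[𝓝 0] (fun t => t ^ (2 * m)) := by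
  obtain ⟨h, hh, hh0, hcrit, K, hK⟩ := exists_critical_curve hF h0 β hβ
  obtain ⟨r, hr, hrβ, hrl, hrr⟩ := exists_smooth_sqrt β
  have hβs : ∀ u w, β u w = β w u := by
    intro u w
    have := partialHessian_symm hF 0 u w
    rwa [← hβ] at this
  have hsym := eventually_symm_sqrt hβs hr.continuousAt hrβ hrl hrr
  -- The shear `σ` straightens the critical curve to `{0} × ℝ`, which removes the linear term of the
  -- Taylor formula for `F ∘ σ`; its inverse is `τ`.
  let σ : U × ℝ → U × ℝ := fun q => (h q.2 + q.1, q.2)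
  let τ : U × ℝ → U × ℝ := fun q => (q.1 - h q.2, q.2)
  have hσ : ContDiff ℝ ∞ σ := ((hh.comp contDiff_snd).add contDiff_fst).prodMk contDiff_snd
  have hτ : ContDiff ℝ ∞ τ := (contDiff_fst.sub (hh.comp contDiff_snd)).prodMk contDiff_snd
  have hτ0 : τ 0 = 0 := by simp [τ, hh0]
  have hσ0 : σ 0 = 0 := by simp [σ, hh0]
  have hστ : ∀ q, σ (τ q) = q := fun q => by ext <;> simp [σ, τ]
  have hF' : ContDiff ℝ ∞ (F ∘ σ) := hF.comp hσ
  have hpd : partialDeriv (F ∘ σ) = partialDeriv F ∘ σ := by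
    funext q
    ext w
    have h1 : HasFDerivAt σ (fderiv ℝ σ q) q := (hσ.differentiable (by simp) q).hasFDerivAt
    have h2 : fderiv ℝ σ q (w, 0) = (w, 0) := by
      have h3 : HasFDerivAt σ _ q := HasFDerivAt.prodMk
        (((hh.differentiable (by simp) q.2).hasFDerivAt.comp q (hasFDerivAt_snd (𝕜 := ℝ))).add
          (hasFDerivAt_fst (𝕜 := ℝ))) (hasFDerivAt_snd (𝕜 := ℝ))
      rw [h3.fderiv]
      simp
    have h4 := ((hF.differentiable (by simp) (σ q)).hasFDerivAt.comp q h1).fderiv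
    rw [partialDeriv_apply, h4, Function.comp_apply, partialDeriv_apply]
    simp [h2]
  have hph : partialHessian (F ∘ σ) 0 = partialHessian F 0 := by
    ext u w
    have h1 : HasFDerivAt σ (fderiv ℝ σ 0) 0 := (hσ.differentiable (by simp) 0).hasFDerivAt
    have h2 : fderiv ℝ σ 0 (u, 0) = (u, 0) := by
      have h3 : HasFDerivAt σ _ 0 := HasFDerivAt.prodMk
        (((hh.differentiable (by simp) (0 : U × ℝ).2).hasFDerivAt.comp 0
          (hasFDerivAt_snd (𝕜 := ℝ))).add (hasFDerivAt_fst (𝕜 := ℝ))) (hasFDerivAt_snd (𝕜 := ℝ))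
      rw [h3.fderiv]
      simp
    have h5 : HasFDerivAt (partialDeriv F) (fderiv ℝ (partialDeriv F) 0) (σ 0) := by
      rw [hσ0]
      exact ((contDiff_partialDeriv hF).differentiable (by simp) 0).hasFDerivAt
    have h4 := (h5.comp 0 h1).fderiv
    rw [partialHessian_apply, ← fderiv_partialDeriv_apply hF', hpd, h4, partialHessian_apply,
      ← fderiv_partialDeriv_apply hF]
    simp [h2]
  obtain ⟨B, hB, hBs, hB0, hBF⟩ := exists_smooth_taylor_two hF'
  -- The factor `2` compensates for the value `½` Hessian of the remainder `B` at the origin, so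
  -- that `T 0 = β` and the root `r` applies near it.
  let T : U × ℝ → U →L[ℝ] U →L[ℝ] ℝ := fun q => (2 : ℝ) • B (τ q)
  have hT0 : T 0 = β := by
    change (2 : ℝ) • B (τ 0) = β
    rw [hτ0, show (0 : U × ℝ) = (0, 0) from rfl, hB0, show ((0 : U), (0 : ℝ)) = 0 from rfl, hph, hβ,
      smul_smul]
    norm_num
  have hT : ContDiff ℝ ∞ T := (hB.comp hτ).const_smul (2 : ℝ)
  let S : U × ℝ → U →L[ℝ] U →L[ℝ] ℝ := fun q => r (T q)
  have hS : IsSmoothGerm S 0 := by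
    refine IsSmoothGerm.comp (f := T) ?_ (hT.isSmoothGerm 0)
    rw [hT0]
    exact hr
  have hS0 : S 0 = β := by
    change r (T 0) = β
    rw [hT0, hrβ]
  have hTc : Tendsto T (𝓝 0) (𝓝 (β : U →L[ℝ] U →L[ℝ] ℝ)) := hT.continuous.tendsto' _ _ hT0
  let v : U × ℝ → U := fun q => q.1 - h q.2
  have hv : ContDiff ℝ ∞ v := contDiff_fst.sub (hh.comp contDiff_snd)
  have hv0 : v 0 = 0 := by simp [v, hh0]
  -- With `S β⁻¹ S = T` and `S` symmetric, the vector `β⁻¹ S v` has `β`-square `T v v = 2 B v v`, so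
  -- the remainder becomes exactly half of the quadratic form.
  let Θ : U × ℝ → U × ℝ := fun q => (β.symm (S q (v q)), q.2)
  have hΘ0 : Θ 0 = 0 := by simp [Θ, hv0]
  have hΘ : IsSmoothGerm Θ 0 := by
    filter_upwards [hS] with q hq
    exact (β.symm.contDiff.contDiffAt.comp q (hq.clm_apply hv.contDiffAt)).prodMk contDiffAt_snd
  have hΘd : HasFDerivAt Θ (shear (ContinuousLinearEquiv.refl ℝ U) (-deriv h 0) :
      U × ℝ →L[ℝ] U × ℝ) 0 := by
    have h1 : HasFDerivAt S (fderiv ℝ S 0) 0 :=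
      (hS.contDiffAt.differentiableAt (by simp)).hasFDerivAt
    have hd : HasDerivAt h (deriv h 0) (0 : U × ℝ).2 :=
      (hh.differentiable (by simp) _).hasDerivAt
    have h2 : HasFDerivAt v _ 0 :=
      (hasFDerivAt_fst (𝕜 := ℝ)).sub (hd.hasFDerivAt.comp (0 : U × ℝ) (hasFDerivAt_snd (𝕜 := ℝ)))
    have h3 : HasFDerivAt Θ _ 0 := ((β.symm : (U →L[ℝ] ℝ) →L[ℝ] U).hasFDerivAt.comp 0
      (h1.clm_apply h2)).prodMk (hasFDerivAt_snd (𝕜 := ℝ))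
    refine h3.congr_fderiv (ContinuousLinearMap.ext fun q => ?_)
    simp [shear_apply, hv0, hS0, sub_eq_add_neg]
  have hloc : ∀ᶠ q in 𝓝 0, F q = F (h q.2, q.2) + 1 / 2 * β (Θ q).1 (Θ q).1 := by
    have hsnd : Tendsto (fun q : U × ℝ => q.2) (𝓝 0) (𝓝 0) := continuous_snd.tendsto' _ _ rfl
    filter_upwards [hTc.eventually hrr, hTc.eventually hsym, hsnd.eventually hcrit]
      with q hq1 hq2 hq3
    have hTs : ∀ u w, T q u w = T q w u := fun u w => by
      change (2 : ℝ) * B (τ q) u w = 2 * B (τ q) w u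
      rw [hBs]
    have e1 := hBF (v q) q.2
    rw [← partialDeriv_apply, hpd] at e1
    have e2 : (F ∘ σ) (v q, q.2) = F q := congrArg F (hστ q)
    have e3 : (F ∘ σ) (0, q.2) = F (h q.2, q.2) := by simp [σ]
    have e4 : (partialDeriv F ∘ σ) (0, q.2) = 0 := by simpa [σ] using hq3
    rw [e2, e3, e4] at e1
    have e5 : T q (v q) (v q) = 2 * B (v q, q.2) (v q) (v q) := rfl
    have e6 : S q (β.symm (S q (v q))) (v q) = T q (v q) (v q) := by
      conv_rhs => rw [← hq1]
      rfl
    have e7 : β (Θ q).1 (Θ q).1 = S q (v q) (β.symm (S q (v q))) := by simp [Θ]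
    rw [e7, ← hq2 hTs, e6, e5, e1]
    simp
  -- The residual function is the critical value. Along `γ` it differs from `F` by the quadratic
  -- form of a vector of size `O(t^m)`, hence by `O(t^(2m))`.
  refine ⟨Θ, fun t => F (h t, t), hΘ.isLocalDiffeomorphAt hΘd, hΘ0,
    hF.comp (hh.prodMk contDiff_id), hloc, ?_⟩
  intro γ m hγ hO
  have hγ' : Tendsto (fun t => (γ t, t)) (𝓝 0) (𝓝 (0 : U × ℝ)) := hγ.prodMk_nhds tendsto_id
  have hO1 : (fun t => v (γ t, t)) =O[𝓝 0] fun t => t ^ m := by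
    refine (Asymptotics.IsBigO.of_bound K ?_).trans hO
    exact hγ'.eventually hK
  have hO2 : (fun t => S (γ t, t) (v (γ t, t))) =O[𝓝 0] fun t => t ^ m := by
    have hb : (fun t => S (γ t, t)) =O[𝓝 0] fun _ => (1 : ℝ) :=
      (hS.continuousAt.tendsto.comp hγ').isBigO_one ℝ
    obtain ⟨C, hC⟩ := hb.bound
    refine (Asymptotics.IsBigO.of_bound C ?_).trans hO1
    filter_upwards [hC] with t ht
    refine (ContinuousLinearMap.le_opNorm _ _).trans ?_
    rw [norm_one, mul_one] at ht
    gcongr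
  have hO3 : (fun t => (Θ (γ t, t)).1) =O[𝓝 0] fun t => t ^ m :=
    ((β.symm : (U →L[ℝ] ℝ) →L[ℝ] U).isBigO_comp _ _).trans hO2
  have hO4 : (fun t => β (Θ (γ t, t)).1 (Θ (γ t, t)).1) =O[𝓝 0] fun t => t ^ (2 * m) := by
    have h1 : (fun t => β (Θ (γ t, t)).1 (Θ (γ t, t)).1) =O[𝓝 0]
        fun t => ‖(Θ (γ t, t)).1‖ * ‖(Θ (γ t, t)).1‖ := by
      refine Asymptotics.IsBigO.of_bound ‖(β : U →L[ℝ] U →L[ℝ] ℝ)‖ (Eventually.of_forall fun t => ?_)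
      refine ((β : U →L[ℝ] U →L[ℝ] ℝ).le_opNorm₂ _ _).trans (le_of_eq ?_)
      rw [norm_mul, norm_norm, mul_assoc]
    refine h1.trans ((hO3.norm_left.mul hO3.norm_left).congr_right fun t => ?_)
    ring
  refine (hO4.const_mul_left (-(1 / 2))).congr' ?_ EventuallyEq.rfl
  filter_upwards [hγ'.eventually hloc] with t ht
  rw [ht]
  simp only [Θ]
  ring

end Splitting

/-! ### Inverting equivalences of germs and transporting critical points. -/

section GermEquivalence

variable {E E' : Type*} [NormedAddCommGroup E] [NormedSpace ℝ E] [NormedAddCommGroup E']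
  [NormedSpace ℝ E']

lemma exists_germ_symm {f : E' → ℝ} {g : E → ℝ} {φ : E → E'} {p : E}
    (hφ : IsLocalDiffeomorphAt 𝓘(ℝ, E) 𝓘(ℝ, E') ∞ φ p) (h : g =ᶠ[𝓝 p] f ∘ φ) :
    ∃ ψ : E' → E, IsLocalDiffeomorphAt 𝓘(ℝ, E') 𝓘(ℝ, E) ∞ ψ (φ p) ∧ ψ (φ p) = p ∧
      f =ᶠ[𝓝 (φ p)] g ∘ ψ := by
  obtain ⟨-, ψ, hψ, hψs, hψp, -, hr⟩ := hφ.exists_germ_inverse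
  refine ⟨ψ, hψ, hψp, ?_⟩
  have ht : Tendsto ψ (𝓝 (φ p)) (𝓝 p) := by
    simpa [hψp] using hψs.continuousAt.tendsto
  filter_upwards [hr, ht.eventually h] with y hy hy'
  rw [Function.comp_apply, hy', Function.comp_apply, hy]

/-- Accumulation of critical points at the base point is invariant under diffeomorphism: the inverse
carries critical points to critical points and, being injective near the point, preserves punctured
neighbourhoods. This is the invariant that refutes determinacy. -/
lemma frequently_fderiv_eq_zero {f : E' → ℝ} {g : E → ℝ} {φ : E → E'} {p : E}
    (hφ : IsLocalDiffeomorphAt 𝓘(ℝ, E) 𝓘(ℝ, E') ∞ φ p) (hf : IsSmoothGerm f (φ p))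
    (h : g =ᶠ[𝓝 p] f ∘ φ) (hc : ∃ᶠ y in 𝓝[≠] (φ p), fderiv ℝ f y = 0) :
    ∃ᶠ x in 𝓝[≠] p, fderiv ℝ g x = 0 := by
  obtain ⟨hφs, ψ, hψ, hψs, hψp, -, hr⟩ := hφ.exists_germ_inverse
  have ht : Tendsto ψ (𝓝 (φ p)) (𝓝 p) := by
    simpa [hψp] using hψs.continuousAt.tendsto
  have ht' : Tendsto ψ (𝓝[≠] (φ p)) (𝓝[≠] p) := by
    refine tendsto_nhdsWithin_iff.2 ⟨ht.mono_left nhdsWithin_le_nhds, ?_⟩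
    filter_upwards [hr.filter_mono nhdsWithin_le_nhds, self_mem_nhdsWithin] with y hy hy0 hyp
    rw [Set.mem_singleton_iff] at hyp
    rw [hyp] at hy
    exact hy0 hy.symm
  refine ht'.frequently ((hc.and_eventually (Eventually.filter_mono nhdsWithin_le_nhds
    (hf.and (hr.and (ht.eventually (hφs.and h.eventuallyEq_nhds)))))).mono ?_)
  rintro y ⟨hy, hfy, hry, hφy, hgy⟩
  have h1 : HasFDerivAt f (fderiv ℝ f y) (φ (ψ y)) := by
    rw [hry]
    exact (hfy.differentiableAt (by simp)).hasFDerivAt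
  rw [hgy.fderiv_eq, (h1.comp (ψ y) (hφy.differentiableAt (by simp)).hasFDerivAt).fderiv, hy]
  simp

end GermEquivalence

/-! ### Jets of functions divisible by a power. -/

section VanishingJets

variable {E : Type*} [NormedAddCommGroup E] [NormedSpace ℝ E]

/-- One factor `θ` is split off in the Leibniz bound. The term that does not differentiate it
contains `θ p = 0`; every other term has at least one derivative fewer on the remaining product,
which vanishes by induction. -/
lemma iteratedFDeriv_pow_mul_eq_zero {θ a : E → ℝ} (hθ : ContDiff ℝ ∞ θ) (ha : ContDiff ℝ ∞ a)
    {p : E} (h0 : θ p = 0) (n : ℕ) :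
    ∀ i < n, iteratedFDeriv ℝ i (fun x => θ x ^ n * a x) p = 0 := by
  induction n with
  | zero => simp
  | succ n ih =>
    intro i hi
    have h := norm_iteratedFDeriv_mul_le hθ ((hθ.pow n).mul ha) p (n := i)
      (WithTop.coe_le_coe.2 le_top)
    rw [show (fun x => θ x ^ (n + 1) * a x) = fun x => θ x * (θ x ^ n * a x) by
      funext x; ring]
    refine norm_le_zero_iff.1 (h.trans (le_of_eq (Finset.sum_eq_zero fun j hj => ?_)))
    rw [Finset.mem_range] at hj
    rcases j with _ | j
    · simp [h0]
    · have : iteratedFDeriv ℝ (i - (j + 1)) (fun x => θ x ^ n * a x) p = 0 := ih _ (by omega)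
      simp [this]

end VanishingJets

/-! ### Normal forms, and determinacy or its failure from the residual function. -/

section Determinacy

variable {U : Type u} [NormedAddCommGroup U] [NormedSpace ℝ U]
  {E : Type*} [NormedAddCommGroup E] [NormedSpace ℝ E]

lemma germDiffeomorphic_of_coords {V G : E → ℝ} {P : E} {N : U × ℝ → ℝ} {Θ Θ' : E → U × ℝ}
    (hΘ : IsLocalDiffeomorphAt 𝓘(ℝ, E) 𝓘(ℝ, U × ℝ) ∞ Θ P) (hΘ0 : Θ P = 0)
    (hV : V =ᶠ[𝓝 P] N ∘ Θ)
    (hΘ' : IsLocalDiffeomorphAt 𝓘(ℝ, E) 𝓘(ℝ, U × ℝ) ∞ Θ' P) (hΘ'0 : Θ' P = 0)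
    (hG : G =ᶠ[𝓝 P] N ∘ Θ') : GermDiffeomorphic V G P := by
  obtain ⟨ψ, hψ, hψ0, hN⟩ := exists_germ_symm hΘ hV
  rw [hΘ0, ← hΘ'0] at hψ hψ0 hN
  refine ⟨ψ ∘ Θ', hψ0, hΘ'.comp 𝓘(ℝ, E) E hψ, ?_⟩
  filter_upwards [hG, hΘ'.contMDiffAt.continuousAt.eventually hN] with x hx hx'
  rw [hx, Function.comp_apply, hx']
  rfl

/-- Here `φ = c + a t^k b(t)` with `b(0) = 1`, so `ρ(t) = t b(t)^(1/k)`. The root is taken of the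
positive function `b` and not of `a`, so neither the sign of `a` nor the parity of `k` matters. -/
lemma exists_pow_coords {φ : ℝ → ℝ} (hφ : ContDiff ℝ ∞ φ) {c a : ℝ} (ha : a ≠ 0) {k : ℕ}
    (hk : k ≠ 0) (hO : (fun t => φ t - (c + a * t ^ k)) =O[𝓝 0] fun t => t ^ (k + 1)) :
    ∃ ρ : ℝ → ℝ, IsSmoothGerm ρ 0 ∧ HasDerivAt ρ 1 0 ∧ ρ 0 = 0 ∧
      ∀ᶠ t in 𝓝 0, φ t = c + a * ρ t ^ k := by
  have hs : ContDiff ℝ ∞ fun t => φ t - (c + a * t ^ k) := by fun_prop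
  obtain ⟨g, hg, hφg⟩ := exists_smooth_div_pow (k + 1) hs (hO.mono nhdsWithin_le_nhds)
  let b : ℝ → ℝ := fun t => 1 + t * g t / a
  have hb : ContDiff ℝ ∞ b := by fun_prop
  have hb0 : b 0 = 1 := by simp [b]
  have hbpos : ∀ᶠ t in 𝓝 0, 0 < b t :=
    hb.continuous.continuousAt.eventually (lt_mem_nhds (by rw [hb0]; exact one_pos))
  have hroot : IsSmoothGerm (fun t => b t ^ (1 / k : ℝ)) 0 := by
    filter_upwards [hbpos] with t ht
    exact hb.contDiffAt.rpow_const_of_ne ht.ne'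
  refine ⟨fun t => t * b t ^ (1 / k : ℝ), ?_, ?_, by simp, ?_⟩
  · filter_upwards [hroot] with t ht
    exact contDiffAt_id.mul ht
  · have h1 := (hasDerivAt_id (0 : ℝ)).mul
      (hroot.contDiffAt.differentiableAt (by simp)).hasDerivAt
    refine h1.congr_deriv ?_
    simp [hb0]
  · filter_upwards [hbpos] with t ht
    have h1 : (b t ^ (1 / k : ℝ)) ^ k = b t := by
      rw [← Real.rpow_natCast, ← Real.rpow_mul ht.le, one_div_mul_cancel (by exact_mod_cast hk),
        Real.rpow_one]
    rw [mul_pow, h1]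
    have h2 := hφg t
    simp only [b]
    field_simp
    linear_combination h2

/-- Coordinates in which the germ of `V` at `P` is the sum of a quadratic form in the first factor
and of a function of the second one. -/
structure SplitCoords (V : E → ℝ) (P : E) (β : U ≃L[ℝ] (U →L[ℝ] ℝ)) (Θ : E → U × ℝ)
    (φ : ℝ → ℝ) : Prop where
  isLocalDiffeomorphAt : IsLocalDiffeomorphAt 𝓘(ℝ, E) 𝓘(ℝ, U × ℝ) ∞ Θ P
  map_base : Θ P = 0
  contDiff : ContDiff ℝ ∞ φ
  eventuallyEq : V =ᶠ[𝓝 P] (fun q => φ q.2 + 1 / 2 * β q.1 q.1) ∘ Θ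

variable {V G : E → ℝ} {P : E} {β : U ≃L[ℝ] (U →L[ℝ] ℝ)} {Θ Θ' : E → U × ℝ} {φ φ' : ℝ → ℝ}

lemma SplitCoords.exists_pow [CompleteSpace U] (h : SplitCoords V P β Θ φ) {c a : ℝ} (ha : a ≠ 0)
    {k : ℕ} (hk : k ≠ 0)
    (hO : (fun t => φ t - (c + a * t ^ k)) =O[𝓝 0] fun t => t ^ (k + 1)) :
    ∃ Θ' : E → U × ℝ, IsLocalDiffeomorphAt 𝓘(ℝ, E) 𝓘(ℝ, U × ℝ) ∞ Θ' P ∧ Θ' P = 0 ∧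
      V =ᶠ[𝓝 P] (fun q => c + a * q.2 ^ k + 1 / 2 * β q.1 q.1) ∘ Θ' := by
  obtain ⟨ρ, hρ, hρd, hρ0, hρφ⟩ := exists_pow_coords h.contDiff ha hk hO
  let R : U × ℝ → U × ℝ := fun q => (q.1, ρ q.2)
  have hsnd : Tendsto (fun q : U × ℝ => q.2) (𝓝 0) (𝓝 0) := continuous_snd.tendsto' _ _ rfl
  have hR : IsSmoothGerm R 0 := by
    filter_upwards [hsnd.eventually hρ] with q hq
    exact contDiffAt_fst.prodMk (hq.comp q contDiffAt_snd)
  have hRd : HasFDerivAt R (ContinuousLinearEquiv.refl ℝ (U × ℝ) : U × ℝ →L[ℝ] U × ℝ) 0 := by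
    have h1 : HasFDerivAt R _ 0 := (hasFDerivAt_fst (𝕜 := ℝ)).prodMk
      (HasFDerivAt.comp (0 : U × ℝ) (f := fun q : U × ℝ => q.2) hρd.hasFDerivAt
        (hasFDerivAt_snd (𝕜 := ℝ)))
    refine h1.congr_fderiv (ContinuousLinearMap.ext fun q => ?_)
    simp
  have hloc := hR.isLocalDiffeomorphAt hRd
  rw [← h.map_base] at hloc
  refine ⟨R ∘ Θ, h.isLocalDiffeomorphAt.comp 𝓘(ℝ, U × ℝ) (U × ℝ) hloc, ?_, ?_⟩
  · simp [R, h.map_base, hρ0]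
  · have hc : Tendsto Θ (𝓝 P) (𝓝 0) := by
      have := h.isLocalDiffeomorphAt.contMDiffAt.continuousAt.tendsto
      rwa [h.map_base] at this
    filter_upwards [h.eventuallyEq, hc.eventually (hsnd.eventually hρφ)] with x hx hx'
    rw [hx]
    simp only [Function.comp_apply, R]
    rw [hx']

/-- Two germs with the same quadratic form and the same leading term are diffeomorphic. -/
theorem SplitCoords.germDiffeomorphic [CompleteSpace U] (h : SplitCoords V P β Θ φ)
    (h' : SplitCoords G P β Θ' φ') {c a : ℝ} (ha : a ≠ 0) {k : ℕ} (hk : k ≠ 0)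
    (hO : (fun t => φ t - (c + a * t ^ k)) =O[𝓝 0] fun t => t ^ (k + 1))
    (hO' : (fun t => φ' t - (c + a * t ^ k)) =O[𝓝 0] fun t => t ^ (k + 1)) :
    GermDiffeomorphic V G P := by
  obtain ⟨Ψ, hΨ, hΨ0, hV⟩ := h.exists_pow ha hk hO
  obtain ⟨Ψ', hΨ', hΨ'0, hG⟩ := h'.exists_pow ha hk hO'
  exact germDiffeomorphic_of_coords hΨ hΨ0 hV hΨ' hΨ'0 hG

lemma sameJet_of_pow_mul [FiniteDimensional ℝ E] {θ : E → ℝ} (hθ : IsSmoothGerm θ P)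
    (h0 : θ P = 0) {a : ℝ → ℝ} (ha : ContDiff ℝ ∞ a) {k : ℕ} (hG : IsSmoothGerm G P)
    (h : V =ᶠ[𝓝 P] fun x => G x + θ x ^ (k + 1) * a (θ x)) : SameJet k V G P := by
  intro i hi
  obtain ⟨η, hη, hηθ⟩ := hθ.exists_contDiff
  have hη0 : η P = 0 := by rw [hηθ.self_of_nhds, h0]
  have h1 : V =ᶠ[𝓝 P] G + fun x => η x ^ (k + 1) * a (η x) := by
    filter_upwards [h, hηθ] with x hx hx'
    rw [hx, Pi.add_apply, hx']
  have hs : ContDiff ℝ ∞ fun x => η x ^ (k + 1) * a (η x) := (hη.pow _).mul (ha.comp hη)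
  have hz : iteratedFDeriv ℝ i (fun x => η x ^ (k + 1) * a (η x)) P = 0 :=
    iteratedFDeriv_pow_mul_eq_zero hη (ha.comp hη) hη0 (k + 1) i (by omega)
  rw [(h1.iteratedFDeriv ℝ i).self_of_nhds, iteratedFDeriv_add_apply
    (hG.contDiffAt.of_le (WithTop.coe_le_coe.2 le_top))
    (hs.contDiffAt.of_le (WithTop.coe_le_coe.2 le_top)),
    hz, add_zero]

/-- If the residual function vanishes to order `k`, the germ is not `k`-determined: a
nearby germ has an isolated critical point, another one has not. -/
theorem SplitCoords.not_isDetermined [FiniteDimensional ℝ E] (h : SplitCoords V P β Θ φ)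
    (hβ : ∀ u w, β u w = β w u) {c : ℝ} {k : ℕ} (hk : k ≠ 0)
    (hO : (fun t => φ t - c) =O[𝓝 0] fun t => t ^ (k + 1)) :
    ¬ IsDetermined k V P := by
  intro hdet
  obtain ⟨g, hg, hφg⟩ := exists_smooth_div_pow (k + 1) (h.contDiff.sub contDiff_const)
    (hO.mono nhdsWithin_le_nhds)
  have hΘs : IsSmoothGerm Θ P := h.isLocalDiffeomorphAt.exists_germ_inverse.1
  have hθs : IsSmoothGerm (fun x => (Θ x).2) P := by
    filter_upwards [hΘs] with x hx
    exact contDiffAt_snd.comp x hx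
  have hθ0 : (Θ P).2 = 0 := by rw [h.map_base]; rfl
  -- For every `ε` the pullback `N ε ∘ Θ` differs from `V` by a multiple of the `(k + 1)`-st power
  -- of a coordinate vanishing at `P`, hence has the same `k`-jet.
  let N : ℝ → U × ℝ → ℝ := fun ε q => c + 1 / 2 * β q.1 q.1 + ε * q.2 ^ (k + 1)
  have hN : ∀ ε, ContDiff ℝ ∞ (N ε) := fun ε => by
    have h1 : ContDiff ℝ ∞ fun q : U × ℝ => β q.1 q.1 :=
      (β.contDiff.comp contDiff_fst).clm_apply contDiff_fst
    exact (contDiff_const.add (contDiff_const.mul h1)).add (by fun_prop)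
  have hNΘ : ∀ ε, IsSmoothGerm (N ε ∘ Θ) P := fun ε => ((hN ε).isSmoothGerm _).comp hΘs
  have hdiff : ∀ ε, GermDiffeomorphic V (N ε ∘ Θ) P := fun ε => by
    refine hdet _ (hNΘ ε) (sameJet_of_pow_mul hθs hθ0 (a := fun t => g t - ε)
      (hg.sub contDiff_const) (hNΘ ε) ?_)
    filter_upwards [h.eventuallyEq] with x hx
    have : φ (Θ x).2 - c = (Θ x).2 ^ (k + 1) * g (Θ x).2 := hφg (Θ x).2
    rw [hx]
    simp only [Function.comp_apply, N]
    linear_combination this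
  have hNd : ∀ ε q v, fderiv ℝ (N ε) q v = β q.1 v.1 + ε * ((k + 1) * q.2 ^ k * v.2) := by
    intro ε q v
    have h1 : HasFDerivAt (fun q : U × ℝ => β q.1 q.1) _ q :=
      ((β : U →L[ℝ] U →L[ℝ] ℝ).hasFDerivAt.comp q (hasFDerivAt_fst (𝕜 := ℝ))).clm_apply
        (hasFDerivAt_fst (𝕜 := ℝ))
    have h2 : HasFDerivAt (fun q : U × ℝ => q.2 ^ (k + 1)) _ q :=
      (hasDerivAt_pow (k + 1) q.2).hasFDerivAt.comp q (hasFDerivAt_snd (𝕜 := ℝ))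
    have h3 : HasFDerivAt (N ε) _ q :=
      ((hasFDerivAt_const c q).add (h1.const_mul (1 / 2))).add (h2.const_mul ε)
    rw [h3.fderiv]
    simp [hβ v.1 q.1]
    ring
  have hcrit0 : ∃ᶠ q in 𝓝[≠] (0 : U × ℝ), fderiv ℝ (N 0) q = 0 := by
    have ht : Tendsto (fun t : ℝ => ((0 : U), t)) (𝓝[≠] 0) (𝓝[≠] 0) := by
      refine tendsto_nhdsWithin_iff.2 ⟨tendsto_nhdsWithin_of_tendsto_nhds
        ((by fun_prop : Continuous fun t : ℝ => ((0 : U), t)).tendsto' _ _ rfl), ?_⟩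
      filter_upwards [self_mem_nhdsWithin] with t ht ht'
      exact ht (congrArg Prod.snd ht')
    refine ht.frequently (Eventually.frequently (Eventually.of_forall fun t => ?_))
    refine ContinuousLinearMap.ext fun v => ?_
    simp [hNd]
  -- A critical point of `N 1` satisfies `β q.1 = 0` and `q.2 ^ k = 0`; since `k ≠ 0`, it is the
  -- origin.
  have hcrit1 : ¬ ∃ᶠ q in 𝓝[≠] (0 : U × ℝ), fderiv ℝ (N 1) q = 0 := by
    rw [not_frequently]
    filter_upwards [self_mem_nhdsWithin] with q hq hq'
    refine hq (Prod.ext ?_ ?_)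
    · refine β.injective (ContinuousLinearMap.ext fun w => ?_)
      have := hNd 1 q (w, 0)
      rw [hq'] at this
      simpa using this.symm
    · have := hNd 1 q (0, 1)
      rw [hq'] at this
      have h2 : ((k : ℝ) + 1) * q.2 ^ k = 0 := by simpa using this.symm
      have h3 : ((k : ℝ) + 1) ≠ 0 := by positivity
      exact pow_eq_zero_iff hk |>.1 ((mul_eq_zero.1 h2).resolve_left h3)
  -- Accumulating critical points are transported from `N 0` through `V` to `N 1`, where there are
  -- none.
  obtain ⟨φ₀, hφ₀P, hφ₀, hV₀⟩ := hdiff 0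
  obtain ⟨φ₁, hφ₁P, hφ₁, hV₁⟩ := hdiff 1
  have hVs : IsSmoothGerm V P := by
    refine IsSmoothGerm.congr (IsSmoothGerm.comp (ContDiff.isSmoothGerm ?_ _) hΘs) h.eventuallyEq
    have h1 : ContDiff ℝ ∞ fun q : U × ℝ => β q.1 q.1 :=
      (β.contDiff.comp contDiff_fst).clm_apply contDiff_fst
    exact (h.contDiff.comp contDiff_snd).add (contDiff_const.mul h1)
  have hcritN₀ : ∃ᶠ x in 𝓝[≠] P, fderiv ℝ (N 0 ∘ Θ) x = 0 :=
    frequently_fderiv_eq_zero h.isLocalDiffeomorphAt ((hN 0).isSmoothGerm _) EventuallyEq.rfl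
      (by rwa [h.map_base])
  obtain ⟨ψ₀, hψ₀, hψ₀P, hVψ⟩ := exists_germ_symm hφ₀ hV₀
  rw [hφ₀P] at hψ₀ hψ₀P hVψ
  have hcritV : ∃ᶠ x in 𝓝[≠] P, fderiv ℝ V x = 0 :=
    frequently_fderiv_eq_zero hψ₀ (by rw [hψ₀P]; exact hNΘ 0) hVψ (by rwa [hψ₀P])
  have hcritN₁ : ∃ᶠ x in 𝓝[≠] P, fderiv ℝ (N 1 ∘ Θ) x = 0 :=
    frequently_fderiv_eq_zero hφ₁ (by rwa [hφ₁P]) hV₁ (by rwa [hφ₁P])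
  obtain ⟨ψ, hψ, hψP, hNψ⟩ := exists_germ_symm (f := N 1) h.isLocalDiffeomorphAt EventuallyEq.rfl
  rw [h.map_base] at hψ hψP hNψ
  exact hcrit1 (frequently_fderiv_eq_zero hψ (by rw [hψP]; exact hNΘ 1) hNψ (by rwa [hψP]))

end Determinacy

/-! ### Growth estimates from vanishing jets. -/

section JetEstimates

/-- The mean value inequality on the closed ball of radius `‖x - P‖` about `P`, where the derivative
is bounded by its bound at the boundary radius. -/
lemma isBigO_pow_succ_of_fderiv {E W : Type*} [NormedAddCommGroup E] [NormedSpace ℝ E]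
    [NormedAddCommGroup W] [NormedSpace ℝ W] {f : E → W} (hf : Differentiable ℝ f) {P : E}
    (h0 : f P = 0) {k : ℕ} (h : fderiv ℝ f =O[𝓝 P] fun x => ‖x - P‖ ^ k) :
    f =O[𝓝 P] fun x => ‖x - P‖ ^ (k + 1) := by
  obtain ⟨C, hC⟩ := h.bound
  obtain ⟨r, hr, hrC⟩ := Metric.eventually_nhds_iff_ball.1 hC
  refine Asymptotics.IsBigO.of_bound C ?_
  filter_upwards [Metric.ball_mem_nhds P hr] with x hx
  have hsub : ∀ y ∈ Metric.closedBall P ‖x - P‖, ‖fderiv ℝ f y‖ ≤ |C| * ‖x - P‖ ^ k := by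
    intro y hy
    rw [mem_closedBall_iff_norm] at hy
    have hyr : y ∈ Metric.ball P r := by
      rw [mem_ball_iff_norm] at hx ⊢
      exact hy.trans_lt hx
    refine (hrC y hyr).trans ?_
    rw [norm_pow, norm_norm]
    gcongr
    exact le_abs_self C
  have := (convex_closedBall P ‖x - P‖).norm_image_sub_le_of_norm_fderiv_le
    (fun y _ => hf y) hsub (Metric.mem_closedBall_self (norm_nonneg _))
    (mem_closedBall_iff_norm.2 le_rfl)
  -- The absolute value makes the bound monotone in the radius; it is harmless, since away from `P`
  -- the constant cannot be negative and at `P` both sides vanish.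
  have hC0 : |C| * ‖x - P‖ ^ (k + 1) = C * ‖x - P‖ ^ (k + 1) := by
    rcases eq_or_ne x P with rfl | hxP
    · simp
    · have h1 := hrC x hx
      have h2 : 0 < ‖‖x - P‖ ^ k‖ := by
        rw [norm_pow, norm_norm]
        exact pow_pos (norm_pos_iff.2 (sub_ne_zero.2 hxP)) k
      have : 0 ≤ C := by
        by_contra hneg
        have := mul_neg_of_neg_of_pos (not_le.1 hneg) h2
        linarith [norm_nonneg (fderiv ℝ f x)]
      rw [abs_of_nonneg this]
  rw [h0, sub_zero] at this
  rw [norm_pow, norm_norm, ← hC0, pow_succ, ← mul_assoc]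
  exact this

lemma isBigO_pow_of_iteratedFDeriv_eq_zero {E : Type u} [NormedAddCommGroup E] [NormedSpace ℝ E]
    (k : ℕ) : ∀ {W : Type u} [NormedAddCommGroup W] [NormedSpace ℝ W] {f : E → W},
    ContDiff ℝ ∞ f → ∀ {P : E}, (∀ i < k, iteratedFDeriv ℝ i f P = 0) →
    f =O[𝓝 P] fun x => ‖x - P‖ ^ k := by
  induction k with
  | zero =>
    intro W _ _ f hf P _
    simpa using hf.continuous.continuousAt.tendsto.isBigO_one ℝ
  | succ k ih =>
    intro W _ _ f hf P h
    refine isBigO_pow_succ_of_fderiv (hf.differentiable (by simp)) ?_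
      (ih (hf.fderiv_right (m := ∞) (by simp)) fun i hi => ?_)
    · have := congrArg norm (h 0 (by omega))
      simpa using this
    · rw [← norm_eq_zero, norm_iteratedFDeriv_fderiv, h (i + 1) (by omega), norm_zero]

lemma isBigO_fderiv_of_iteratedFDeriv_eq_zero {E : Type u} [NormedAddCommGroup E] [NormedSpace ℝ E]
    {k : ℕ} {f : E → ℝ} (hf : ContDiff ℝ ∞ f) {P : E}
    (h : ∀ i ≤ k, iteratedFDeriv ℝ i f P = 0) :
    fderiv ℝ f =O[𝓝 P] fun x => ‖x - P‖ ^ k := by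
  refine isBigO_pow_of_iteratedFDeriv_eq_zero k (hf.fderiv_right (m := ∞) (by simp))
    fun i hi => ?_
  rw [← norm_eq_zero, norm_iteratedFDeriv_fderiv, h (i + 1) (by omega), norm_zero]

lemma pow_isBigO_pow {m n : ℕ} (h : m ≤ n) :
    (fun t : ℝ => t ^ n) =O[𝓝 0] fun t : ℝ => t ^ m := by
  rcases h.eq_or_lt with rfl | h
  · exact Asymptotics.isBigO_refl _ _
  · exact (Asymptotics.isLittleO_pow_pow h).isBigO

end JetEstimates

/-! ### Determinacy criteria along a curve of almost critical points. -/

section Criteria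

variable {U : Type u} [NormedAddCommGroup U] [NormedSpace ℝ U]
  {E : Type u} [NormedAddCommGroup E] [NormedSpace ℝ E]

lemma isDetermined_congr {V V' : E → ℝ} {P : E} (h : V =ᶠ[𝓝 P] V') {k : ℕ}
    (hV : IsDetermined k V P) : IsDetermined k V' P := by
  intro g hg hj
  obtain ⟨φ, hφP, hφ, hgφ⟩ := hV g hg fun i hi => by
    rw [(h.iteratedFDeriv ℝ i).self_of_nhds, hj i hi]
  have ht : Tendsto φ (𝓝 P) (𝓝 P) := by
    have := hφ.contMDiffAt.continuousAt.tendsto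
    rwa [hφP] at this
  refine ⟨φ, hφP, hφ, ?_⟩
  filter_upwards [hgφ, ht.eventually h] with x hx hx'
  rw [hx, Function.comp_apply, hx']
  rfl

lemma isDetermined_mono {V : E → ℝ} {P : E} {k l : ℕ} (hkl : k ≤ l) (h : IsDetermined k V P) :
    IsDetermined l V P :=
  fun g hg hj => h g hg fun i hi => hj i (hi.trans hkl)

variable [FiniteDimensional ℝ U] [FiniteDimensional ℝ E] {V : E → ℝ} {P : E} (L : (U × ℝ) ≃L[ℝ] E) {β : U ≃L[ℝ] (U →L[ℝ] ℝ)}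

lemma exists_splitCoords (hV : ContDiff ℝ ∞ V)
    (h0 : partialDeriv (fun q => V (P + L q)) 0 = 0)
    (hβ : (β : U →L[ℝ] U →L[ℝ] ℝ) = partialHessian (fun q => V (P + L q)) 0) :
    ∃ (Θ : E → U × ℝ) (φ : ℝ → ℝ), SplitCoords V P β Θ φ ∧
      ∀ (γ : ℝ → U) (m : ℕ), Tendsto γ (𝓝 0) (𝓝 0) →
        (fun t => partialDeriv (fun q => V (P + L q)) (γ t, t)) =O[𝓝 0] (fun t => t ^ m) →
        (fun t => φ t - V (P + L (γ t, t))) =O[𝓝 0] (fun t => t ^ (2 * m)) := by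
  have hF : ContDiff ℝ ∞ fun q => V (P + L q) :=
    hV.comp (contDiff_const.add L.contDiff)
  obtain ⟨Θ, φ, hΘ, hΘ0, hφ, hloc, hcurve⟩ := exists_splitting hF h0 β hβ
  let A : E → U × ℝ := fun x => L.symm (x - P)
  have hA : ContDiff ℝ ∞ A := L.symm.contDiff.comp (contDiff_id.sub contDiff_const)
  have hA0 : A P = 0 := by simp [A]
  have hAd : HasFDerivAt A (L.symm : E →L[ℝ] U × ℝ) P :=
    (L.symm : E →L[ℝ] U × ℝ).hasFDerivAt.comp P ((hasFDerivAt_id P).sub_const P)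
  have hAl := (hA.isSmoothGerm P).isLocalDiffeomorphAt hAd
  rw [← hA0] at hΘ
  refine ⟨Θ ∘ A, φ, ⟨hAl.comp 𝓘(ℝ, U × ℝ) (U × ℝ) hΘ, ?_, hφ, ?_⟩, hcurve⟩
  · simp [hA0, hΘ0]
  · have ht : Tendsto A (𝓝 P) (𝓝 0) := hA.continuous.tendsto' _ _ hA0
    filter_upwards [ht.eventually hloc] with x hx
    simpa [A] using hx

/-- The trial curve of `V` serves for every `G` with the same `k`-jet. `2 ≤ k` preserves the
gradient and the form `β`; `m ≤ k` absorbs the `O(t^k)` change of the partial derivative; `k + 1 ≤ 2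
m` makes the splitting error invisible at the order in question. Thus `G` has the same leading term
as `V`. -/
lemma exists_splitCoords_of_sameJet {G : E → ℝ} (hV : ContDiff ℝ ∞ V) (hG : ContDiff ℝ ∞ G)
    (h0 : partialDeriv (fun q => V (P + L q)) 0 = 0)
    (hβ : (β : U →L[ℝ] U →L[ℝ] ℝ) = partialHessian (fun q => V (P + L q)) 0)
    {γ : ℝ → U} (hγ : γ =O[𝓝 0] fun t => t) {k m : ℕ} (hk : 2 ≤ k) (hmk : m ≤ k)
    (hkm : k + 1 ≤ 2 * m)
    (hpd : (fun t => partialDeriv (fun q => V (P + L q)) (γ t, t)) =O[𝓝 0] fun t => t ^ m)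
    {c a : ℝ}
    (hval : (fun t => V (P + L (γ t, t)) - (c + a * t ^ k)) =O[𝓝 0] fun t => t ^ (k + 1))
    (hj : SameJet k V G P) :
    ∃ (Θ : E → U × ℝ) (φ : ℝ → ℝ), SplitCoords G P β Θ φ ∧
      (fun t => φ t - (c + a * t ^ k)) =O[𝓝 0] fun t => t ^ (k + 1) := by
  let D : E → ℝ := G - V
  have hD : ContDiff ℝ ∞ D := hG.sub hV
  have hDj : ∀ i ≤ k, iteratedFDeriv ℝ i D P = 0 := by
    intro i hi
    rw [iteratedFDeriv_sub_apply (hG.contDiffAt.of_le (WithTop.coe_le_coe.2 le_top))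
      (hV.contDiffAt.of_le (WithTop.coe_le_coe.2 le_top)), hj i hi, sub_self]
  let A : U × ℝ → E := fun q => P + L q
  have hA : ContDiff ℝ ∞ A := contDiff_const.add L.contDiff
  have hAt : Tendsto A (𝓝 0) (𝓝 P) := hA.continuous.tendsto' _ _ (by simp [A])
  have hAO : (fun q => ‖A q - P‖) =O[𝓝 0] fun q => ‖q‖ := by
    have : (fun q => A q - P) = fun q => L q := by funext q; simp [A]
    rw [Asymptotics.isBigO_norm_norm, this]
    exact (L : U × ℝ →L[ℝ] E).isBigO_id _
  have hF : ∀ {W : E → ℝ}, ContDiff ℝ ∞ W → ContDiff ℝ ∞ fun q => W (P + L q) :=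
    fun hW => hW.comp hA
  have hDO := isBigO_fderiv_of_iteratedFDeriv_eq_zero hD hDj
  have hDP : D P = 0 := by simpa using congrArg norm (hDj 0 (by omega))
  have hO1 : (fun q => D (A q)) =O[𝓝 0] fun q => ‖q‖ ^ (k + 1) :=
    ((isBigO_pow_succ_of_fderiv (hD.differentiable (by simp)) hDP hDO).comp_tendsto hAt).trans (hAO.pow (k + 1))
  have hFd : ∀ {W : E → ℝ}, ContDiff ℝ ∞ W → ∀ q, fderiv ℝ (fun q => W (P + L q)) q =
      (fderiv ℝ W (A q)).comp (L : U × ℝ →L[ℝ] E) := by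
    intro W hW q
    have h1 : HasFDerivAt A (L : U × ℝ →L[ℝ] E) q :=
      (L : U × ℝ →L[ℝ] E).hasFDerivAt.const_add P
    exact ((hW.differentiable (by simp) (A q)).hasFDerivAt.comp q h1).fderiv
  have hO2 : (fun q => partialDeriv (fun q => D (P + L q)) q) =O[𝓝 0] fun q => ‖q‖ ^ k := by
    have h1 : (fun q => partialDeriv (fun q => D (P + L q)) q) =O[𝓝 0]
        fun q => fderiv ℝ D (A q) := by
      refine Asymptotics.IsBigO.of_bound
        (‖(L : U × ℝ →L[ℝ] E)‖ * ‖ContinuousLinearMap.inl ℝ U ℝ‖) (Eventually.of_forall fun q => ?_)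
      rw [partialDeriv, hFd hD]
      refine (ContinuousLinearMap.opNorm_comp_le _ _).trans ?_
      refine (mul_le_mul_of_nonneg_right (ContinuousLinearMap.opNorm_comp_le _ _)
        (norm_nonneg _)).trans (le_of_eq ?_)
      ring
    exact h1.trans ((hDO.comp_tendsto hAt).trans
      (hAO.pow k))
  have hpdD : ∀ q, partialDeriv (fun q => G (P + L q)) q =
      partialDeriv (fun q => V (P + L q)) q + partialDeriv (fun q => D (P + L q)) q := by
    intro q
    have : fderiv ℝ D (A q) = fderiv ℝ G (A q) - fderiv ℝ V (A q) :=
      fderiv_sub (hG.differentiable (by simp) _) (hV.differentiable (by simp) _)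
    simp only [partialDeriv, hFd hG, hFd hV, hFd hD, this]
    ext u
    simp
  -- A map of size `O(‖q‖^k)` with `k > 1` has zero derivative at the origin, so `G` and `V` have
  -- the same partial Hessian.
  have hpdD' : HasFDerivAt (partialDeriv fun q => D (P + L q))
      (0 : U × ℝ →L[ℝ] U →L[ℝ] ℝ) 0 :=
    Asymptotics.IsBigO.hasFDerivAt (𝕜 := ℝ) (n := k) (by simpa using hO2) (by omega)
  have hD0 : partialDeriv (fun q => D (P + L q)) 0 = 0 := by
    obtain ⟨C, hC⟩ := hO2.bound
    have := hC.self_of_nhds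
    rw [norm_zero, zero_pow (by omega), norm_zero, mul_zero] at this
    exact norm_le_zero_iff.1 this
  have hG0 : partialDeriv (fun q => G (P + L q)) 0 = 0 := by rw [hpdD, h0, hD0, add_zero]
  have hGβ : (β : U →L[ℝ] U →L[ℝ] ℝ) = partialHessian (fun q => G (P + L q)) 0 := by
    rw [hβ]
    ext u w
    rw [partialHessian_apply, partialHessian_apply, ← fderiv_partialDeriv_apply (hF hV),
      ← fderiv_partialDeriv_apply (hF hG)]
    have h1 : partialDeriv (fun q => G (P + L q)) = fun q =>
      partialDeriv (fun q => V (P + L q)) q + partialDeriv (fun q => D (P + L q)) q := funext hpdD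
    have h2 := (((contDiff_partialDeriv (hF hV)).differentiable (by simp) 0).hasFDerivAt.add
      hpdD').fderiv
    rw [h1, show fderiv ℝ (fun q => partialDeriv (fun q => V (P + L q)) q +
      partialDeriv (fun q => D (P + L q)) q) 0 = _ from h2, add_zero]
  obtain ⟨Θ, φ, hΘ, hcurve⟩ := exists_splitCoords L hG hG0 hGβ
  have hγt : Tendsto γ (𝓝 0) (𝓝 0) := hγ.trans_tendsto tendsto_id
  have hq : Tendsto (fun t => (γ t, t)) (𝓝 0) (𝓝 (0 : U × ℝ)) := hγt.prodMk_nhds tendsto_id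
  have hqO : (fun t => ‖(γ t, t)‖) =O[𝓝 0] fun t => t :=
    (hγ.prod_left (Asymptotics.isBigO_refl _ _)).norm_left
  have h1 : (fun t => partialDeriv (fun q => G (P + L q)) (γ t, t)) =O[𝓝 0] fun t => t ^ m := by
    simp only [hpdD]
    exact hpd.add (((hO2.comp_tendsto hq).trans (hqO.pow k)).trans (pow_isBigO_pow hmk))
  have h2 := (hcurve γ m hγt h1).trans (pow_isBigO_pow hkm)
  have h3 : (fun t => D (A (γ t, t))) =O[𝓝 0] fun t => t ^ (k + 1) :=
    (hO1.comp_tendsto hq).trans (hqO.pow (k + 1))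
  -- Three errors add up: `φ` against `G` on the curve, `G` against `V` there, and `V` against its
  -- leading term.
  refine ⟨Θ, φ, hΘ, ((h2.add h3).add hval).congr_left fun t => ?_⟩
  simp only [D, A, Pi.sub_apply]
  ring

/-- A germ is `k`-determined if it grows like `t ^ k` along a curve of almost critical points. -/
theorem isDetermined_of_curve (hV : ContDiff ℝ ∞ V)
    (h0 : partialDeriv (fun q => V (P + L q)) 0 = 0)
    (hβ : (β : U →L[ℝ] U →L[ℝ] ℝ) = partialHessian (fun q => V (P + L q)) 0)
    {γ : ℝ → U} (hγ : γ =O[𝓝 0] fun t => t) {k m : ℕ} (hk : 2 ≤ k) (hmk : m ≤ k)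
    (hkm : k + 1 ≤ 2 * m)
    (hpd : (fun t => partialDeriv (fun q => V (P + L q)) (γ t, t)) =O[𝓝 0] fun t => t ^ m)
    {c a : ℝ} (ha : a ≠ 0)
    (hval : (fun t => V (P + L (γ t, t)) - (c + a * t ^ k)) =O[𝓝 0] fun t => t ^ (k + 1)) :
    IsDetermined k V P := by
  intro g hg hj
  obtain ⟨G, hG, hGg⟩ := hg.exists_contDiff
  have hj' : SameJet k V G P := fun i hi => by
    rw [(hGg.iteratedFDeriv ℝ i).self_of_nhds, hj i hi]
  obtain ⟨Θ, φ, hΘ, hφ⟩ := exists_splitCoords_of_sameJet L hV hV h0 hβ hγ hk hmk hkm hpd hval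
    fun _ _ => rfl
  obtain ⟨Θ', φ', hΘ', hφ'⟩ := exists_splitCoords_of_sameJet L hV hG h0 hβ hγ hk hmk hkm hpd hval
    hj'
  obtain ⟨ψ, hψP, hψ, hGψ⟩ := hΘ.germDiffeomorphic hΘ' ha (by omega) hφ hφ'
  exact ⟨ψ, hψP, hψ, hGg.symm.trans hGψ⟩

/-- A germ is not `k`-determined if it is constant to order `k` along a curve of almost critical
points. -/
theorem not_isDetermined_of_curve (hV : ContDiff ℝ ∞ V)
    (h0 : partialDeriv (fun q => V (P + L q)) 0 = 0)
    (hβ : (β : U →L[ℝ] U →L[ℝ] ℝ) = partialHessian (fun q => V (P + L q)) 0)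
    {γ : ℝ → U} (hγ : γ =O[𝓝 0] fun t => t) {k m : ℕ} (hk : 2 ≤ k) (hmk : m ≤ k)
    (hkm : k + 1 ≤ 2 * m)
    (hpd : (fun t => partialDeriv (fun q => V (P + L q)) (γ t, t)) =O[𝓝 0] fun t => t ^ m)
    {c : ℝ} (hval : (fun t => V (P + L (γ t, t)) - c) =O[𝓝 0] fun t => t ^ (k + 1)) :
    ¬ IsDetermined k V P := by
  obtain ⟨Θ, φ, hΘ, hφ⟩ := exists_splitCoords_of_sameJet L hV hV h0 hβ hγ hk hmk hkm hpd
    (c := c) (a := 0) (by simpa using hval) fun _ _ => rfl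
  refine hΘ.not_isDetermined (fun u w => ?_) (by omega) (c := c) (by simpa using hφ)
  have hF : ContDiff ℝ ∞ fun q => V (P + L q) := hV.comp (contDiff_const.add L.contDiff)
  have := partialHessian_symm hF 0 u w
  rwa [← hβ] at this

end Criteria

/-! ### Directional derivatives and Taylor expansions along parabolas. -/

section Directional

variable {E : Type*} [NormedAddCommGroup E] [NormedSpace ℝ E]

/-- The directional derivative. -/
noncomputable def dirDeriv (v : E) (f : E → ℝ) (p : E) : ℝ := fderiv ℝ f p v

lemma contDiff_dirDeriv {f : E → ℝ} (hf : ContDiff ℝ ∞ f) (v : E) :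
    ContDiff ℝ ∞ (dirDeriv v f) :=
  (hf.fderiv_right (m := ∞) (by simp)).clm_apply contDiff_const

lemma dirDeriv_dirDeriv {f : E → ℝ} (hf : ContDiff ℝ ∞ f) (v w p : E) :
    dirDeriv v (dirDeriv w f) p = fderiv ℝ (fderiv ℝ f) p v w := by
  have hd : DifferentiableAt ℝ (fderiv ℝ f) p :=
    (hf.fderiv_right (m := ∞) (by simp)).differentiable (by simp) p
  have := (hd.hasFDerivAt.clm_apply (hasFDerivAt_const w p)).fderiv
  rw [dirDeriv, show fderiv ℝ (dirDeriv w f) p = _ from this]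
  simp

lemma dirDeriv_comm {f : E → ℝ} (hf : ContDiff ℝ ∞ f) (v w : E) :
    dirDeriv v (dirDeriv w f) = dirDeriv w (dirDeriv v f) := by
  funext p
  rw [dirDeriv_dirDeriv hf, dirDeriv_dirDeriv hf]
  refine (hf.contDiffAt.isSymmSndFDerivAt ?_).eq _ _
  simp only [minSmoothness_of_isRCLikeNormedField]
  exact WithTop.coe_le_coe.2 le_top

lemma dirDeriv_add_left (v w : E) (f : E → ℝ) (p : E) :
    dirDeriv (v + w) f p = dirDeriv v f p + dirDeriv w f p := map_add _ _ _

lemma dirDeriv_smul_left (a : ℝ) (v : E) (f : E → ℝ) (p : E) :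
    dirDeriv (a • v) f p = a * dirDeriv v f p := map_smul _ _ _

lemma dirDeriv_zero_left (f : E → ℝ) (p : E) : dirDeriv (0 : E) f p = 0 := map_zero _

/-! Expansions of a smooth function along the curve `t ↦ P + t e + t² c`. -/

lemma isBigO_pow_succ_of_hasDerivAt {g g' : ℝ → ℝ} (hg : ∀ t, HasDerivAt g (g' t) t) (h0 : g 0 = 0)
    {k : ℕ} (h : g' =O[𝓝 0] fun t => t ^ k) : g =O[𝓝 0] fun t => t ^ (k + 1) := by
  have h1 : fderiv ℝ g =O[𝓝 0] fun t => ‖t - 0‖ ^ k := by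
    refine Asymptotics.IsBigO.trans ?_ (h.trans ?_)
    · refine Asymptotics.IsBigO.of_bound 1 (Eventually.of_forall fun t => ?_)
      rw [← norm_deriv_eq_norm_fderiv, (hg t).deriv, one_mul]
    · refine Asymptotics.IsBigO.of_bound 1 (Eventually.of_forall fun t => ?_)
      simp
  refine (isBigO_pow_succ_of_fderiv (fun t => (hg t).differentiableAt) h0 h1).trans ?_
  refine Asymptotics.IsBigO.of_bound 1 (Eventually.of_forall fun t => ?_)
  simp

variable {f : E → ℝ} (P e c : E)

lemma hasDerivAt_comp_curve (hf : ContDiff ℝ ∞ f) (t : ℝ) :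
    HasDerivAt (fun t : ℝ => f (P + t • e + t ^ 2 • c))
      (dirDeriv e f (P + t • e + t ^ 2 • c) + 2 * t * dirDeriv c f (P + t • e + t ^ 2 • c)) t := by
  have h1 : HasDerivAt (fun t : ℝ => P + t • e + t ^ 2 • c) (e + (2 * t) • c) t := by
    have := (((hasDerivAt_id t).smul_const e).const_add P).add ((hasDerivAt_pow 2 t).smul_const c)
    exact this.congr_deriv (by simp)
  have h2 := (hf.differentiable (by simp) (P + t • e + t ^ 2 • c)).hasFDerivAt.comp_hasDerivAt t h1
  refine h2.congr_deriv ?_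
  rw [map_add, map_smul]
  rfl

/-- The start of a ladder. The derivative of `f` along the curve is `∂_e f + 2 t ∂_c f`; each
further expansion applies earlier ones to `∂_e f` and, one order lower because of the factor `t`, to
`∂_c f`, and then integrates. -/
lemma curve_expansion_one (hf : ContDiff ℝ ∞ f) :
    (fun t : ℝ => f (P + t • e + t ^ 2 • c) - f P) =O[𝓝 0] fun t => t ^ 1 := by
  refine isBigO_pow_succ_of_hasDerivAt (fun t => (hasDerivAt_comp_curve P e c hf t).sub_const _)
    (by simp) ?_
  have h1 := (contDiff_dirDeriv hf e).continuous
  have h2 := (contDiff_dirDeriv hf c).continuous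
  have : Continuous fun t : ℝ => dirDeriv e f (P + t • e + t ^ 2 • c)
    + 2 * t * dirDeriv c f (P + t • e + t ^ 2 • c) := by fun_prop
  simpa using this.continuousAt.tendsto.isBigO_one ℝ

lemma mul_isBigO_pow_succ {g : ℝ → ℝ} {k : ℕ} (h : g =O[𝓝 0] fun t => t ^ k) :
    (fun t => 2 * t * g t) =O[𝓝 0] fun t => t ^ (k + 1) := by
  have h1 : (fun t : ℝ => 2 * t) =O[𝓝 0] fun t => t :=
    (Asymptotics.isBigO_refl _ _).const_mul_left 2
  exact (h1.mul h).congr_right fun t => by ring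

lemma curve_expansion_two (hf : ContDiff ℝ ∞ f) :
    (fun t : ℝ => f (P + t • e + t ^ 2 • c) - (f P + t * dirDeriv e f P))
      =O[𝓝 0] fun t => t ^ 2 := by
  refine isBigO_pow_succ_of_hasDerivAt (fun t => (hasDerivAt_comp_curve P e c hf t).sub
    (((hasDerivAt_id t).mul_const _).const_add _)) (by simp) ?_
  have h1 := curve_expansion_one P e c (contDiff_dirDeriv hf e)
  have h2 : (fun t : ℝ => dirDeriv c f (P + t • e + t ^ 2 • c)) =O[𝓝 0] fun t => t ^ 0 := by
    have h2 := (contDiff_dirDeriv hf c).continuous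
    have : Continuous fun t : ℝ => dirDeriv c f (P + t • e + t ^ 2 • c) := by fun_prop
    simpa using this.continuousAt.tendsto.isBigO_one ℝ
  refine (h1.add (mul_isBigO_pow_succ h2)).congr_left fun t => ?_
  ring

lemma curve_expansion_three (hf : ContDiff ℝ ∞ f) :
    (fun t : ℝ => f (P + t • e + t ^ 2 • c) - (f P + t * dirDeriv e f P
      + t ^ 2 * (dirDeriv e (dirDeriv e f) P / 2 + dirDeriv c f P))) =O[𝓝 0] fun t => t ^ 3 := by
  refine isBigO_pow_succ_of_hasDerivAt (fun t => (hasDerivAt_comp_curve P e c hf t).sub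
    ((((hasDerivAt_id t).mul_const _).const_add _).add ((hasDerivAt_pow 2 t).mul_const _)))
    (by simp) ?_
  have h1 := curve_expansion_two P e c (contDiff_dirDeriv hf e)
  have h2 := mul_isBigO_pow_succ (curve_expansion_one P e c (contDiff_dirDeriv hf c))
  refine (h1.add h2).congr_left fun t => ?_
  push_cast
  ring

lemma curve_expansion_four (hf : ContDiff ℝ ∞ f) :
    (fun t : ℝ => f (P + t • e + t ^ 2 • c) - (f P + t * dirDeriv e f P
      + t ^ 2 * (dirDeriv e (dirDeriv e f) P / 2 + dirDeriv c f P)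
      + t ^ 3 * (dirDeriv e (dirDeriv e (dirDeriv e f)) P / 6 + dirDeriv c (dirDeriv e f) P)))
      =O[𝓝 0] fun t => t ^ 4 := by
  refine isBigO_pow_succ_of_hasDerivAt (fun t => (hasDerivAt_comp_curve P e c hf t).sub
    (((((hasDerivAt_id t).mul_const _).const_add _).add ((hasDerivAt_pow 2 t).mul_const _)).add
      ((hasDerivAt_pow 3 t).mul_const _))) (by simp) ?_
  have h1 := curve_expansion_three P e c (contDiff_dirDeriv hf e)
  have h2 := mul_isBigO_pow_succ (curve_expansion_two P e c (contDiff_dirDeriv hf c))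
  refine (h1.add h2).congr_left fun t => ?_
  rw [dirDeriv_comm hf e c]
  push_cast
  ring

lemma curve_expansion_five (hf : ContDiff ℝ ∞ f) :
    (fun t : ℝ => f (P + t • e + t ^ 2 • c) - (f P + t * dirDeriv e f P
      + t ^ 2 * (dirDeriv e (dirDeriv e f) P / 2 + dirDeriv c f P)
      + t ^ 3 * (dirDeriv e (dirDeriv e (dirDeriv e f)) P / 6 + dirDeriv c (dirDeriv e f) P)
      + t ^ 4 * (dirDeriv e (dirDeriv e (dirDeriv e (dirDeriv e f))) P / 24
        + dirDeriv c (dirDeriv e (dirDeriv e f)) P / 2 + dirDeriv c (dirDeriv c f) P / 2)))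
      =O[𝓝 0] fun t => t ^ 5 := by
  refine isBigO_pow_succ_of_hasDerivAt (fun t => (hasDerivAt_comp_curve P e c hf t).sub
    ((((((hasDerivAt_id t).mul_const _).const_add _).add ((hasDerivAt_pow 2 t).mul_const _)).add
      ((hasDerivAt_pow 3 t).mul_const _)).add ((hasDerivAt_pow 4 t).mul_const _))) (by simp) ?_
  have h1 := curve_expansion_four P e c (contDiff_dirDeriv hf e)
  have h2 := mul_isBigO_pow_succ (curve_expansion_three P e c (contDiff_dirDeriv hf c))
  refine (h1.add h2).congr_left fun t => ?_
  rw [dirDeriv_comm hf e c, dirDeriv_comm (contDiff_dirDeriv hf e) e c]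
  push_cast
  ring

end Directional

/-! ### Symmetry and locality of iterated partial derivatives. -/

section PartialDerivatives

variable {n : ℕ}

lemma pd_cons (i : Fin n) (l : List (Fin n)) (f : (Fin n → ℝ) → ℝ) :
    pd (i :: l) f = dirDeriv (Pi.single i 1) (pd l f) := rfl

lemma contDiff_pd {f : (Fin n → ℝ) → ℝ} (hf : ContDiff ℝ ∞ f) :
    ∀ l : List (Fin n), ContDiff ℝ ∞ (pd l f)
  | [] => hf
  | _ :: l => contDiff_dirDeriv (contDiff_pd hf l) _

lemma pd_perm {f : (Fin n → ℝ) → ℝ} (hf : ContDiff ℝ ∞ f) {l l' : List (Fin n)}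
    (h : l.Perm l') : pd l f = pd l' f := by
  induction h with
  | nil => rfl
  | cons i _ ih => rw [pd_cons, pd_cons, ih]
  | swap i j l => exact dirDeriv_comm (contDiff_pd hf l) _ _
  | trans _ _ h1 h2 => rw [h1, h2]

lemma pd_congr {f g : (Fin n → ℝ) → ℝ} {P : Fin n → ℝ} (h : f =ᶠ[𝓝 P] g) :
    ∀ l : List (Fin n), pd l f =ᶠ[𝓝 P] pd l g
  | [] => h
  | i :: l => by
    filter_upwards [(pd_congr h l).eventuallyEq_nhds] with p hp
    simp only [pd]
    rw [hp.fderiv_eq]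

end PartialDerivatives

/-! ### Vanishing of odd derivatives. -/

section Parity

/-- The diagonal linear map with entries `s`. -/
noncomputable def diagMap {n : ℕ} (s : Fin n → ℝ) : (Fin n → ℝ) →L[ℝ] (Fin n → ℝ) :=
  ContinuousLinearMap.pi fun i => s i • ContinuousLinearMap.proj i

lemma diagMap_apply {n : ℕ} (s p : Fin n → ℝ) (i : Fin n) : diagMap s p i = s i * p i := by
  simp [diagMap]

lemma diagMap_single {n : ℕ} (s : Fin n → ℝ) (i : Fin n) :
    diagMap s (Pi.single i 1) = s i • Pi.single i 1 := by
  ext j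
  rw [diagMap_apply]
  by_cases h : j = i
  · subst h; simp
  · simp [h]

/-- Partial derivatives of a function that is invariant under sign changes. -/
lemma pd_comp_diagMap {n : ℕ} {s : Fin n → ℝ} (hs : ∀ i, s i * s i = 1) {f : (Fin n → ℝ) → ℝ}
    (hf : ContDiff ℝ ∞ f) {P : Fin n → ℝ} (h : ∀ᶠ p in 𝓝 P, f (diagMap s p) = f p) :
    ∀ l : List (Fin n), ∀ᶠ p in 𝓝 P, pd l f (diagMap s p) = (l.map s).prod * pd l f p
  | [] => by simpa [pd] using h
  | i :: l => by
    filter_upwards [(pd_comp_diagMap hs hf h l).eventually_nhds] with p hp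
    have hd := (contDiff_pd hf l).differentiable (by simp)
    have h1 : HasFDerivAt (fun p => pd l f (diagMap s p)) _ p :=
      (hd (diagMap s p)).hasFDerivAt.comp p (diagMap s).hasFDerivAt
    have h2 := ((hd p).hasFDerivAt.const_mul (l.map s).prod)
    have h3 := h1.unique (h2.congr_of_eventuallyEq hp)
    have h4 := DFunLike.congr_fun h3 (Pi.single i 1)
    rw [ContinuousLinearMap.comp_apply, diagMap_single, map_smul] at h4
    simp only [smul_eq_mul, _root_.smul_apply] at h4
    simp only [pd, List.map_cons, List.prod_cons]
    -- Multiplication by `s i` moves the sign to the other side, as `s i ^ 2 = 1`.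
    linear_combination s i * h4 - hs i * fderiv ℝ (pd l f) (diagMap s p) (Pi.single i 1)

lemma pd_eq_zero_of_odd {n : ℕ} {s : Fin n → ℝ} (hs : ∀ i, s i * s i = 1) {f : (Fin n → ℝ) → ℝ}
    (hf : ContDiff ℝ ∞ f) {P : Fin n → ℝ} (h : ∀ᶠ p in 𝓝 P, f (diagMap s p) = f p)
    (hP : diagMap s P = P) {l : List (Fin n)} (hl : (l.map s).prod = -1) : pd l f P = 0 := by
  have := (pd_comp_diagMap hs hf h l).self_of_nhds
  rw [hP, hl] at this
  linarith

end Parity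

/-! ### Coordinates adapted to the soft direction. -/

section Frame

/-- The linear coordinates on `ℝ⁴` adapted to the direction `(0, 0, -a, 1)`. -/
noncomputable def frame (a : ℝ) : ((Fin 3 → ℝ) × ℝ) ≃L[ℝ] (Fin 4 → ℝ) :=
  LinearEquiv.toContinuousLinearEquiv
    { toFun := fun q => ![q.1 0, q.1 1, q.1 2 - a * q.2, q.2]
      invFun := fun x => (![x 0, x 1, x 2 + a * x 3], x 3)
      map_add' := fun p q => by
        ext i
        fin_cases i <;> simp
        ring
      map_smul' := fun r q => by
        ext i
        fin_cases i <;> simp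
        ring
      left_inv := fun q => by
        ext i
        · fin_cases i <;> simp
        · simp
      right_inv := fun x => by
        ext i
        fin_cases i <;> simp }

lemma frame_apply (a : ℝ) (q : (Fin 3 → ℝ) × ℝ) :
    frame a q = ![q.1 0, q.1 1, q.1 2 - a * q.2, q.2] := rfl

lemma frame_single (a : ℝ) (i : Fin 3) :
    frame a (Pi.single i 1, 0) = Pi.single i.castSucc 1 := by
  rw [frame_apply]
  ext j
  fin_cases i <;> fin_cases j <;> simp

lemma frame_left (a : ℝ) (u : Fin 3 → ℝ) :
    frame a (u, 0) = u 0 • Pi.single 0 1 + (u 1 • Pi.single 1 1 + u 2 • Pi.single 2 1) := by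
  rw [frame_apply]
  ext j
  fin_cases j <;> simp

/-- Identifies trial curves in the adapted coordinates with the parabolas of the expansion lemmas.
-/
lemma frame_curve (a : ℝ) (c : Fin 3 → ℝ) (P : Fin 4 → ℝ) (t : ℝ) :
    P + frame a (t ^ 2 • c, t) = P + t • ((-a) • Pi.single 2 1 + Pi.single 3 1)
      + t ^ 2 • frame a (c, 0) := by
  rw [frame_apply, frame_apply]
  ext j
  fin_cases j <;> simp
  ring

variable {V : (Fin 4 → ℝ) → ℝ} (P : Fin 4 → ℝ) (a : ℝ)

lemma fderiv_comp_frame (hV : ContDiff ℝ ∞ V) (q v : (Fin 3 → ℝ) × ℝ) :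
    fderiv ℝ (fun q => V (P + frame a q)) q v = dirDeriv (frame a v) V (P + frame a q) := by
  have h1 : HasFDerivAt (fun q => P + frame a q)
      (frame a : (Fin 3 → ℝ) × ℝ →L[ℝ] (Fin 4 → ℝ)) q :=
    (frame a : (Fin 3 → ℝ) × ℝ →L[ℝ] (Fin 4 → ℝ)).hasFDerivAt.const_add P
  have h2 := ((hV.differentiable (by simp) (P + frame a q)).hasFDerivAt.comp q h1).fderiv
  rw [show fderiv ℝ (fun q => V (P + frame a q)) q = _ from h2]
  rfl

lemma partialDeriv_comp_frame (hV : ContDiff ℝ ∞ V) (q : (Fin 3 → ℝ) × ℝ) (u : Fin 3 → ℝ) :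
    partialDeriv (fun q => V (P + frame a q)) q u =
      dirDeriv (frame a (u, 0)) V (P + frame a q) := by
  rw [partialDeriv_apply, fderiv_comp_frame P a hV]

lemma partialHessian_comp_frame (hV : ContDiff ℝ ∞ V) (u w : Fin 3 → ℝ) :
    partialHessian (fun q => V (P + frame a q)) 0 u w =
      dirDeriv (frame a (u, 0)) (dirDeriv (frame a (w, 0)) V) P := by
  have hF : ContDiff ℝ ∞ fun q => V (P + frame a q) := hV.comp (contDiff_const.add (frame a).contDiff)
  have h1 := dirDeriv_dirDeriv hF (u, 0) (w, 0) 0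
  have h2 : dirDeriv ((w, 0) : (Fin 3 → ℝ) × ℝ) (fun q => V (P + frame a q)) =
      fun q => dirDeriv (frame a (w, 0)) V (P + frame a q) :=
    funext fun q => fderiv_comp_frame P a hV q (w, 0)
  rw [partialHessian_apply, ← h1, h2, dirDeriv, fderiv_comp_frame P a (contDiff_dirDeriv hV _)]
  simp

lemma clm_isBigO_of_single {n : ℕ} {ℓ : ℝ → (Fin n → ℝ) →L[ℝ] ℝ} {g : ℝ → ℝ}
    (h : ∀ i, (fun t => ℓ t (Pi.single i 1)) =O[𝓝 0] g) : ℓ =O[𝓝 0] g := by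
  have h1 : ℓ = fun t => ∑ i, (ℓ t (Pi.single i 1)) •
      (ContinuousLinearMap.proj i : (Fin n → ℝ) →L[ℝ] ℝ) := by
    funext t
    refine ContinuousLinearMap.ext fun u => ?_
    have hu : u = ∑ i, u i • Pi.single i (1 : ℝ) := by
      ext j
      simp [Finset.sum_apply, Pi.single_apply]
    conv_lhs => rw [hu]
    simp [mul_comm]
  rw [h1]
  suffices h3 : ∀ i ∈ Finset.univ, (fun t => (ℓ t (Pi.single i 1)) •
      (ContinuousLinearMap.proj i : (Fin n → ℝ) →L[ℝ] ℝ)) =O[𝓝 0] g from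
    Asymptotics.IsBigO.fun_sum h3
  intro i _
  have h2 : (fun t => (ℓ t (Pi.single i 1)) •
      (ContinuousLinearMap.proj i : (Fin n → ℝ) →L[ℝ] ℝ)) =O[𝓝 0]
        fun t => ℓ t (Pi.single i 1) := by
    refine Asymptotics.IsBigO.of_bound
      ‖(ContinuousLinearMap.proj i : (Fin n → ℝ) →L[ℝ] ℝ)‖ (Eventually.of_forall fun t => ?_)
    rw [norm_smul, mul_comm]
  exact h2.trans (h i)

/-- A nondegenerate form embeds `U` in its dual, and equality of dimensions makes this an
isomorphism. -/
lemma exists_equiv_dual {U : Type*} [NormedAddCommGroup U] [NormedSpace ℝ U]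
    [FiniteDimensional ℝ U] (b : U →L[ℝ] U →L[ℝ] ℝ) (hb : ∀ u, b u = 0 → u = 0) :
    ∃ β : U ≃L[ℝ] (U →L[ℝ] ℝ), (β : U →L[ℝ] U →L[ℝ] ℝ) = b := by
  have hfin : Module.finrank ℝ U = Module.finrank ℝ (U →L[ℝ] ℝ) := by
    rw [← (LinearMap.toContinuousLinearMap : (U →ₗ[ℝ] ℝ) ≃ₗ[ℝ] (U →L[ℝ] ℝ)).finrank_eq]
    exact Subspace.dual_finrank_eq.symm
  refine ⟨(LinearEquiv.ofInjectiveOfFinrankEq b.toLinearMap ?_ hfin).toContinuousLinearEquiv, ?_⟩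
  · exact (injective_iff_map_eq_zero _).2 hb
  · ext u w
    rfl

end Frame

/-! ### Symmetric potentials: the quadratic and cubic terms of the residual function. -/

section Symmetric

variable {V : (Fin 4 → ℝ) → ℝ} {P : Fin 4 → ℝ}

/-- The function `V` is smooth and even in the last two variables near the point `P`, whose last two
coordinates vanish. -/
structure IsSymmetricPotential (V : (Fin 4 → ℝ) → ℝ) (P : Fin 4 → ℝ) : Prop where
  contDiff : ContDiff ℝ ∞ V
  symm : ∀ᶠ p in 𝓝 P, V ![p 0, p 1, -p 2, -p 3] = V p
  coord_two : P 2 = 0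
  coord_three : P 3 = 0

/-- Derivatives with an odd number of indices from `z, w` vanish at a point fixed by the symmetry.
The signs are integers so that the parity condition can be settled by `decide`. -/
lemma IsSymmetricPotential.pd_eq_zero (h : IsSymmetricPotential V P) {l : List (Fin 4)}
    (hl : (l.map (![1, 1, -1, -1] : Fin 4 → ℤ)).prod = -1) : pd l V P = 0 := by
  let s : Fin 4 → ℝ := fun i => ((![1, 1, -1, -1] : Fin 4 → ℤ) i : ℝ)
  have hd : ∀ p, diagMap s p = ![p 0, p 1, -p 2, -p 3] := fun p => by
    ext i
    rw [diagMap_apply]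
    fin_cases i <;> simp [s]
  refine pd_eq_zero_of_odd (s := s) (fun i => ?_) h.contDiff ?_ ?_ ?_
  · fin_cases i <;> simp [s]
  · filter_upwards [h.symm] with p hp
    rw [hd, hp]
  · rw [hd]
    ext i
    fin_cases i <;> simp [h.coord_two, h.coord_three]
  · have := congrArg (Int.cast : ℤ → ℝ) hl
    rw [Int.cast_list_prod, List.map_map] at this
    exact this.trans (by norm_num)

/-- The direction `(0, 0, -a, 1)`. -/
noncomputable def softDir (a : ℝ) : Fin 4 → ℝ := (-a) • Pi.single 2 1 + Pi.single 3 1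

lemma dirDeriv_softDir (a : ℝ) (f : (Fin 4 → ℝ) → ℝ) (p : Fin 4 → ℝ) :
    dirDeriv (softDir a) f p = -a * pd [2] f p + pd [3] f p := by
  rw [softDir, dirDeriv_add_left, dirDeriv_smul_left]
  rfl

lemma dirDeriv_softDir_two {f : (Fin 4 → ℝ) → ℝ} (hf : ContDiff ℝ ∞ f) (a : ℝ) (p : Fin 4 → ℝ) :
    dirDeriv (softDir a) (dirDeriv (softDir a) f) p =
      a ^ 2 * pd [2, 2] f p - 2 * a * pd [2, 3] f p + pd [3, 3] f p := by
  have c : ∀ i : Fin 4, pd [i] (dirDeriv (softDir a) f) = dirDeriv (softDir a) (pd [i] f) :=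
    fun i => dirDeriv_comm hf _ _
  rw [dirDeriv_softDir, c, c, dirDeriv_softDir, dirDeriv_softDir]
  change -a * (-a * pd [2, 2] f p + pd [3, 2] f p) + (-a * pd [2, 3] f p + pd [3, 3] f p) = _
  rw [pd_perm hf (show List.Perm [3, 2] [2, 3] by decide)]
  ring

lemma dirDeriv_softDir_two_comm {f : (Fin 4 → ℝ) → ℝ} (hf : ContDiff ℝ ∞ f) (a : ℝ)
    (v : Fin 4 → ℝ) : dirDeriv v (dirDeriv (softDir a) (dirDeriv (softDir a) f)) =
      dirDeriv (softDir a) (dirDeriv (softDir a) (dirDeriv v f)) := by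
  rw [dirDeriv_comm (contDiff_dirDeriv hf _), dirDeriv_comm hf v]

lemma dirDeriv_softDir_three (h : IsSymmetricPotential V P) (a : ℝ) :
    dirDeriv (softDir a) (dirDeriv (softDir a) (dirDeriv (softDir a) V)) P = 0 := by
  have hz : ∀ i : Fin 4, i = 2 ∨ i = 3 →
      dirDeriv (softDir a) (dirDeriv (softDir a) (pd [i] V)) P = 0 := by
    intro i hi
    rw [dirDeriv_softDir_two (contDiff_pd h.contDiff _)]
    change a ^ 2 * pd [2, 2, i] V P - 2 * a * pd [2, 3, i] V P + pd [3, 3, i] V P = 0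
    rcases hi with rfl | rfl
    · rw [h.pd_eq_zero (l := [2, 2, 2]) (by decide), h.pd_eq_zero (l := [2, 3, 2]) (by decide),
        h.pd_eq_zero (l := [3, 3, 2]) (by decide)]
      ring
    · rw [h.pd_eq_zero (l := [2, 2, 3]) (by decide), h.pd_eq_zero (l := [2, 3, 3]) (by decide),
        h.pd_eq_zero (l := [3, 3, 3]) (by decide)]
      ring
  rw [dirDeriv_softDir]
  change -a * dirDeriv _ _ P + dirDeriv _ _ P = 0
  simp only [pd]
  rw [dirDeriv_softDir_two_comm h.contDiff, dirDeriv_softDir_two_comm h.contDiff]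
  change -a * dirDeriv _ (dirDeriv _ (pd [2] V)) P + dirDeriv _ (dirDeriv _ (pd [3] V)) P = 0
  rw [hz 2 (Or.inl rfl), hz 3 (Or.inr rfl)]
  ring

lemma dirDeriv_softDir_four (hV : ContDiff ℝ ∞ V) :
    dirDeriv (softDir (α V P)) (dirDeriv (softDir (α V P)) (dirDeriv (softDir (α V P))
      (dirDeriv (softDir (α V P)) V))) P = D4 V P := by
  have hc : ∀ i j : Fin 4, pd [i, j] (dirDeriv (softDir (α V P)) (dirDeriv (softDir (α V P)) V)) P =
      dirDeriv (softDir (α V P)) (dirDeriv (softDir (α V P)) (pd [i, j] V)) P := by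
    intro i j
    rw [pd_cons, pd_cons, pd, dirDeriv_softDir_two_comm hV,
      dirDeriv_softDir_two_comm (contDiff_dirDeriv hV _)]
    rfl
  rw [dirDeriv_softDir_two (contDiff_dirDeriv (contDiff_dirDeriv hV _) _), hc, hc, hc,
    dirDeriv_softDir_two (contDiff_pd hV _), dirDeriv_softDir_two (contDiff_pd hV _),
    dirDeriv_softDir_two (contDiff_pd hV _)]
  change α V P ^ 2 * (α V P ^ 2 * pd [2, 2, 2, 2] V P - 2 * α V P * pd [2, 3, 2, 2] V P +
      pd [3, 3, 2, 2] V P) - 2 * α V P * (α V P ^ 2 * pd [2, 2, 2, 3] V P -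
      2 * α V P * pd [2, 3, 2, 3] V P + pd [3, 3, 2, 3] V P) + (α V P ^ 2 * pd [2, 2, 3, 3] V P -
      2 * α V P * pd [2, 3, 3, 3] V P + pd [3, 3, 3, 3] V P) = D4 V P
  rw [pd_perm hV (show List.Perm [2, 3, 2, 2] [2, 2, 2, 3] by decide),
    pd_perm hV (show List.Perm [3, 3, 2, 2] [2, 2, 3, 3] by decide),
    pd_perm hV (show List.Perm [2, 3, 2, 3] [2, 2, 3, 3] by decide),
    pd_perm hV (show List.Perm [3, 3, 2, 3] [2, 3, 3, 3] by decide), D4]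
  ring

lemma dirDeriv_frame_left (a : ℝ) (u : Fin 3 → ℝ) (f : (Fin 4 → ℝ) → ℝ) (p : Fin 4 → ℝ) :
    dirDeriv (frame a (u, 0)) f p = u 0 * pd [0] f p + u 1 * pd [1] f p + u 2 * pd [2] f p := by
  rw [frame_left, dirDeriv_add_left, dirDeriv_add_left, dirDeriv_smul_left, dirDeriv_smul_left,
    dirDeriv_smul_left, ← add_assoc]
  rfl

/-- The hypotheses on the critical point of a symmetric potential. -/
structure IsSymmetricCritical (V : (Fin 4 → ℝ) → ℝ) (P : Fin 4 → ℝ) : Prop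
    extends IsSymmetricPotential V P where
  fderiv_eq_zero : fderiv ℝ V P = 0
  det_pos : 0 < pd [0, 0] V P * pd [1, 1] V P - pd [0, 1] V P ^ 2
  zz_ne_zero : pd [2, 2] V P ≠ 0

lemma IsSymmetricCritical.dirDeriv_eq_zero (h : IsSymmetricCritical V P) (v : Fin 4 → ℝ) :
    dirDeriv v V P = 0 := by
  rw [dirDeriv, h.fderiv_eq_zero]
  rfl

/-- By parity the form on the `u`-space splits into the block in `x, y`, of positive determinant,
and the entry `V_zz ≠ 0`, so its kernel is trivial. -/
lemma IsSymmetricCritical.exists_equiv (h : IsSymmetricCritical V P) (a : ℝ) :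
    ∃ β : (Fin 3 → ℝ) ≃L[ℝ] ((Fin 3 → ℝ) →L[ℝ] ℝ),
      (β : (Fin 3 → ℝ) →L[ℝ] (Fin 3 → ℝ) →L[ℝ] ℝ) =
        partialHessian (fun q => V (P + frame a q)) 0 := by
  refine exists_equiv_dual _ fun u hu => ?_
  have key : ∀ i : Fin 3, u 0 * pd [0, i.castSucc] V P + u 1 * pd [1, i.castSucc] V P
      + u 2 * pd [2, i.castSucc] V P = 0 := by
    intro i
    have h1 := DFunLike.congr_fun hu (Pi.single i 1)
    rw [partialHessian_comp_frame P a h.contDiff, dirDeriv_frame_left, frame_single] at h1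
    exact h1
  have k0 : u 0 * pd [0, 0] V P + u 1 * pd [1, 0] V P + u 2 * pd [2, 0] V P = 0 := key 0
  have k1 : u 0 * pd [0, 1] V P + u 1 * pd [1, 1] V P + u 2 * pd [2, 1] V P = 0 := key 1
  have k2 : u 0 * pd [0, 2] V P + u 1 * pd [1, 2] V P + u 2 * pd [2, 2] V P = 0 := key 2
  rw [h.pd_eq_zero (l := [2, 0]) (by decide),
    pd_perm h.contDiff (show List.Perm [1, 0] [0, 1] by decide)] at k0
  rw [h.pd_eq_zero (l := [2, 1]) (by decide)] at k1
  rw [h.pd_eq_zero (l := [0, 2]) (by decide), h.pd_eq_zero (l := [1, 2]) (by decide)] at k2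
  have hd := h.det_pos.ne'
  have u0 : u 0 = 0 := by
    refine (mul_eq_zero.1 ?_).resolve_right hd
    linear_combination pd [1, 1] V P * k0 - pd [0, 1] V P * k1
  have u1 : u 1 = 0 := by
    refine (mul_eq_zero.1 ?_).resolve_right hd
    linear_combination pd [0, 0] V P * k1 - pd [0, 1] V P * k0
  have u2 : u 2 = 0 := by
    refine (mul_eq_zero.1 ?_).resolve_right h.zz_ne_zero
    linear_combination k2
  ext i
  fin_cases i
  exacts [u0, u1, u2]

lemma IsSymmetricCritical.partialDeriv_eq_zero (h : IsSymmetricCritical V P) (a : ℝ) :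
    partialDeriv (fun q => V (P + frame a q)) 0 = 0 := by
  ext u
  rw [partialDeriv_comp_frame P a h.contDiff, map_zero, add_zero, h.dirDeriv_eq_zero]
  rfl

/-- This is what `α` is chosen for: against `z` the equation is `-α V_zz + V_zw = 0`, while against
`x` and `y` it holds by parity. Hence the soft line is critical to second order. -/
lemma IsSymmetricCritical.dirDeriv_pd_eq_zero (h : IsSymmetricCritical V P) (i : Fin 3) :
    dirDeriv (softDir (α V P)) (pd [i.castSucc] V) P = 0 := by
  rw [dirDeriv_softDir]
  change -α V P * pd [2, i.castSucc] V P + pd [3, i.castSucc] V P = 0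
  fin_cases i
  · change -α V P * pd [2, 0] V P + pd [3, 0] V P = 0
    rw [h.pd_eq_zero (l := [2, 0]) (by decide), h.pd_eq_zero (l := [3, 0]) (by decide)]
    ring
  · change -α V P * pd [2, 1] V P + pd [3, 1] V P = 0
    rw [h.pd_eq_zero (l := [2, 1]) (by decide), h.pd_eq_zero (l := [3, 1]) (by decide)]
    ring
  · change -α V P * pd [2, 2] V P + pd [3, 2] V P = 0
    rw [pd_perm h.contDiff (show List.Perm [3, 2] [2, 3] by decide), α,
      neg_mul, div_mul_cancel₀ _ h.zz_ne_zero]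
    ring

lemma frame_line (a : ℝ) (P : Fin 4 → ℝ) (t : ℝ) :
    P + frame a (0, t) = P + t • softDir a + t ^ 2 • (0 : Fin 4 → ℝ) := by
  have hc := frame_curve a 0 P t
  rwa [smul_zero, show ((0 : Fin 3 → ℝ), (0 : ℝ)) = 0 from rfl, map_zero] at hc

lemma isBigO_partialDeriv_line (h : IsSymmetricCritical V P) :
    (fun t : ℝ => partialDeriv (fun q => V (P + frame (α V P) q)) ((0 : Fin 3 → ℝ), t))
      =O[𝓝 0] fun t => t ^ 2 := by
  refine clm_isBigO_of_single fun i => ?_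
  refine (curve_expansion_two P (softDir (α V P)) 0
    (contDiff_pd h.contDiff [i.castSucc])).congr_left fun t => ?_
  have h0 : pd [i.castSucc] V P = 0 := h.dirDeriv_eq_zero _
  rw [partialDeriv_comp_frame P _ h.contDiff, frame_single, frame_line, h0,
    h.dirDeriv_pd_eq_zero, mul_zero, add_zero, sub_zero]
  rfl

lemma D2_eq (hV : ContDiff ℝ ∞ V) :
    dirDeriv (softDir (α V P)) (dirDeriv (softDir (α V P)) V) P = D2 V P :=
  dirDeriv_softDir_two hV _ _

theorem IsSymmetricCritical.isDetermined_two (h : IsSymmetricCritical V P) (hD : D2 V P ≠ 0) :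
    IsDetermined 2 V P := by
  obtain ⟨β, hβ⟩ := h.exists_equiv (α V P)
  refine isDetermined_of_curve (frame (α V P)) h.contDiff (h.partialDeriv_eq_zero _) hβ
    (γ := fun _ => 0) (Asymptotics.isBigO_zero _ _) (k := 2) (m := 2) le_rfl le_rfl (by norm_num)
    (isBigO_partialDeriv_line h) (c := V P) (a := D2 V P / 2) (by simpa using hD) ?_
  refine (curve_expansion_three P (softDir (α V P)) 0 h.contDiff).congr_left fun t => ?_
  rw [h.dirDeriv_eq_zero, h.dirDeriv_eq_zero, D2_eq h.contDiff, frame_line]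
  ring

theorem IsSymmetricCritical.not_isDetermined_three (h : IsSymmetricCritical V P)
    (hD : D2 V P = 0) : ¬ IsDetermined 3 V P := by
  obtain ⟨β, hβ⟩ := h.exists_equiv (α V P)
  -- For `k = 3`, `m = 2` the condition `k + 1 ≤ 2 m` is an equality, so the straight line still
  -- sees the cubic term but nothing beyond.
  refine not_isDetermined_of_curve (frame (α V P)) h.contDiff (h.partialDeriv_eq_zero _) hβ
    (γ := fun _ => 0) (Asymptotics.isBigO_zero _ _) (k := 3) (m := 2) (by norm_num) (by norm_num)
    (by norm_num) (isBigO_partialDeriv_line h) (c := V P) ?_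
  refine (curve_expansion_four P (softDir (α V P)) 0 h.contDiff).congr_left fun t => ?_
  rw [h.dirDeriv_eq_zero, h.dirDeriv_eq_zero, D2_eq h.contDiff, frame_line, hD,
    dirDeriv_softDir_three h.toIsSymmetricPotential, dirDeriv_zero_left]
  ring

end Symmetric

/-! ### The quartic term, along the bent trial curve. -/

section Quartic

variable {V : (Fin 4 → ℝ) → ℝ} {P : Fin 4 → ℝ}

/-- The second order term of the curve of almost critical points. -/
noncomputable def bend (V : (Fin 4 → ℝ) → ℝ) (P : Fin 4 → ℝ) : Fin 3 → ℝ :=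
  ![-(κ V P 0 * pd [1, 1] V P - κ V P 1 * pd [0, 1] V P) /
      (2 * (pd [0, 0] V P * pd [1, 1] V P - pd [0, 1] V P ^ 2)),
    -(κ V P 1 * pd [0, 0] V P - κ V P 0 * pd [0, 1] V P) /
      (2 * (pd [0, 0] V P * pd [1, 1] V P - pd [0, 1] V P ^ 2)), 0]

lemma bend_two : bend V P 2 = 0 := rfl

/-- Cramer's rule for `H₁ b = -κ / 2`, the condition that the `t²` term of the gradient vanish along
the parabola. This is the `x` equation; the `z` component of `b` can be zero because `κ₃ = 0`. -/
lemma IsSymmetricCritical.bend_eq_zero (h : IsSymmetricCritical V P) :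
    κ V P 0 / 2 + (bend V P 0 * pd [0, 0] V P + bend V P 1 * pd [0, 1] V P) = 0 := by
  have hd := h.det_pos.ne'
  simp only [bend, Matrix.cons_val_zero, Matrix.cons_val_one]
  obtain ⟨Δ, hΔ⟩ : ∃ Δ, Δ = pd [0, 0] V P * pd [1, 1] V P - pd [0, 1] V P ^ 2 := ⟨_, rfl⟩
  rw [← hΔ] at hd ⊢
  field_simp
  rw [hΔ]
  ring

lemma IsSymmetricCritical.bend_eq_one (h : IsSymmetricCritical V P) :
    κ V P 1 / 2 + (bend V P 0 * pd [0, 1] V P + bend V P 1 * pd [1, 1] V P) = 0 := by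
  have hd := h.det_pos.ne'
  simp only [bend, Matrix.cons_val_zero, Matrix.cons_val_one]
  obtain ⟨Δ, hΔ⟩ : ∃ Δ, Δ = pd [0, 0] V P * pd [1, 1] V P - pd [0, 1] V P ^ 2 := ⟨_, rfl⟩
  rw [← hΔ] at hd ⊢
  field_simp
  rw [hΔ]
  ring

lemma dirDeriv_softDir_pd (hV : ContDiff ℝ ∞ V) (i : Fin 3) :
    dirDeriv (softDir (α V P)) (dirDeriv (softDir (α V P)) (pd [i.castSucc] V)) P = κ V P i := by
  rw [dirDeriv_softDir_two (contDiff_pd hV _)]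
  change α V P ^ 2 * pd [2, 2, i.castSucc] V P - 2 * α V P * pd [2, 3, i.castSucc] V P
    + pd [3, 3, i.castSucc] V P = _
  rw [pd_perm hV (show List.Perm [2, 2, i.castSucc] [i.castSucc, 2, 2] from
      (List.perm_append_comm (l₁ := [2, 2]) (l₂ := [i.castSucc]))),
    pd_perm hV (show List.Perm [2, 3, i.castSucc] [i.castSucc, 2, 3] from
      (List.perm_append_comm (l₁ := [2, 3]) (l₂ := [i.castSucc]))),
    pd_perm hV (show List.Perm [3, 3, i.castSucc] [i.castSucc, 3, 3] from
      (List.perm_append_comm (l₁ := [3, 3]) (l₂ := [i.castSucc]))), κ]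

lemma IsSymmetricPotential.kappa_two (h : IsSymmetricPotential V P) : κ V P 2 = 0 := by
  change α V P ^ 2 * pd [2, 2, 2] V P - 2 * α V P * pd [2, 2, 3] V P + pd [2, 3, 3] V P = 0
  rw [h.pd_eq_zero (l := [2, 2, 2]) (by decide), h.pd_eq_zero (l := [2, 2, 3]) (by decide),
    h.pd_eq_zero (l := [2, 3, 3]) (by decide)]
  ring

/-- The term in `t` is removed by the choice of `α` and the term in `t²` by that of `bend`. -/
lemma isBigO_partialDeriv_parabola (h : IsSymmetricCritical V P) :
    (fun t : ℝ => partialDeriv (fun q => V (P + frame (α V P) q)) (t ^ 2 • bend V P, t))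
      =O[𝓝 0] fun t => t ^ 3 := by
  refine clm_isBigO_of_single fun i => ?_
  refine (curve_expansion_three P (softDir (α V P)) (frame (α V P) (bend V P, 0))
    (contDiff_pd h.contDiff [i.castSucc])).congr_left fun t => ?_
  have h0 : pd [i.castSucc] V P = 0 := h.dirDeriv_eq_zero _
  have hz : κ V P i / 2 + dirDeriv (frame (α V P) (bend V P, 0)) (pd [i.castSucc] V) P = 0 := by
    rw [dirDeriv_frame_left, bend_two]
    fin_cases i
    · change κ V P 0 / 2 + (_ * pd [0, 0] V P + _ * pd [1, 0] V P + _) = 0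
      rw [pd_perm h.contDiff (show List.Perm [1, 0] [0, 1] by decide)]
      linear_combination h.bend_eq_zero
    · change κ V P 1 / 2 + (_ * pd [0, 1] V P + _ * pd [1, 1] V P + _) = 0
      linear_combination h.bend_eq_one
    · change κ V P 2 / 2 + (_ * pd [0, 2] V P + _ * pd [1, 2] V P + _) = 0
      rw [h.kappa_two, h.pd_eq_zero (l := [0, 2]) (by decide),
        h.pd_eq_zero (l := [1, 2]) (by decide)]
      ring
  rw [partialDeriv_comp_frame P _ h.contDiff, frame_single, frame_curve, h0,
    h.dirDeriv_pd_eq_zero, dirDeriv_softDir_pd h.contDiff, hz, mul_zero, mul_zero, add_zero,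
    add_zero, sub_zero]
  rfl

/-- The quartic coefficient is `D4 / 24 + b·κ / 2 + b·H₁ b / 2`. The quadratic term vanishes by `hD`
and criticality, the cubic one by parity and the choice of `α`. -/
lemma IsSymmetricCritical.value_parabola (h : IsSymmetricCritical V P) (hD : D2 V P = 0) :
    (fun t : ℝ => V (P + frame (α V P) (t ^ 2 • bend V P, t)) - (V P + reducedQuartic V P /
      (24 * (pd [0, 0] V P * pd [1, 1] V P - pd [0, 1] V P ^ 2)) * t ^ 4))
      =O[𝓝 0] fun t => t ^ 5 := by
  refine (curve_expansion_five P (softDir (α V P)) (frame (α V P) (bend V P, 0))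
    h.contDiff).congr_left fun t => ?_
  have hV := h.contDiff
  have e1 : dirDeriv (frame (α V P) (bend V P, 0)) (dirDeriv (softDir (α V P)) V) P = 0 := by
    have hc : ∀ i : Fin 3, pd [i.castSucc] (dirDeriv (softDir (α V P)) V) P = 0 := fun i => by
      rw [pd_cons, pd, dirDeriv_comm hV]
      exact h.dirDeriv_pd_eq_zero i
    rw [dirDeriv_frame_left]
    change _ * pd [(0 : Fin 3).castSucc] _ P + _ * pd [(1 : Fin 3).castSucc] _ P
      + _ * pd [(2 : Fin 3).castSucc] _ P = 0
    rw [hc, hc, hc]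
    ring
  have e2 : dirDeriv (frame (α V P) (bend V P, 0))
      (dirDeriv (softDir (α V P)) (dirDeriv (softDir (α V P)) V)) P =
      bend V P 0 * κ V P 0 + bend V P 1 * κ V P 1 := by
    have hc : ∀ i : Fin 3, pd [i.castSucc]
        (dirDeriv (softDir (α V P)) (dirDeriv (softDir (α V P)) V)) P = κ V P i := fun i => by
      rw [pd_cons, pd, dirDeriv_softDir_two_comm hV]
      exact dirDeriv_softDir_pd hV i
    rw [dirDeriv_frame_left, bend_two, zero_mul, add_zero]
    exact congrArg₂ _ (congrArg _ (hc 0)) (congrArg _ (hc 1))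
  have e3 : dirDeriv (frame (α V P) (bend V P, 0)) (dirDeriv (frame (α V P) (bend V P, 0)) V) P =
      bend V P 0 * (bend V P 0 * pd [0, 0] V P + bend V P 1 * pd [0, 1] V P) +
      bend V P 1 * (bend V P 0 * pd [0, 1] V P + bend V P 1 * pd [1, 1] V P) := by
    have hc : ∀ i : Fin 4, pd [i] (dirDeriv (frame (α V P) (bend V P, 0)) V) P =
        bend V P 0 * pd [0, i] V P + bend V P 1 * pd [1, i] V P := fun i => by
      rw [pd_cons, pd, dirDeriv_comm hV]
      change dirDeriv _ (pd [i] V) P = _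
      rw [dirDeriv_frame_left, bend_two, zero_mul, add_zero]
      rfl
    rw [dirDeriv_frame_left, bend_two, hc, hc,
      pd_perm hV (show List.Perm [1, 0] [0, 1] by decide)]
    ring
  have hq : D4 V P / 24 + (bend V P 0 * κ V P 0 + bend V P 1 * κ V P 1) / 2 +
      (bend V P 0 * (bend V P 0 * pd [0, 0] V P + bend V P 1 * pd [0, 1] V P) +
        bend V P 1 * (bend V P 0 * pd [0, 1] V P + bend V P 1 * pd [1, 1] V P)) / 2 =
      reducedQuartic V P / (24 * (pd [0, 0] V P * pd [1, 1] V P - pd [0, 1] V P ^ 2)) := by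
    have b0 := h.bend_eq_zero
    have b1 := h.bend_eq_one
    have hd := h.det_pos.ne'
    have hb0 : bend V P 0 = -(κ V P 0 * pd [1, 1] V P - κ V P 1 * pd [0, 1] V P) /
      (2 * (pd [0, 0] V P * pd [1, 1] V P - pd [0, 1] V P ^ 2)) := rfl
    have hb1 : bend V P 1 = -(κ V P 1 * pd [0, 0] V P - κ V P 0 * pd [0, 1] V P) /
      (2 * (pd [0, 0] V P * pd [1, 1] V P - pd [0, 1] V P ^ 2)) := rfl
    -- The equation `H₁ b = -κ / 2` turns `b·H₁ b / 2` into `-b·κ / 4`; inserting the formula for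
    -- `b` then produces the common denominator `24 det H₁`.
    have hs : D4 V P / 24 + (bend V P 0 * κ V P 0 + bend V P 1 * κ V P 1) / 2 +
      (bend V P 0 * (bend V P 0 * pd [0, 0] V P + bend V P 1 * pd [0, 1] V P) +
        bend V P 1 * (bend V P 0 * pd [0, 1] V P + bend V P 1 * pd [1, 1] V P)) / 2 =
      D4 V P / 24 + (bend V P 0 * κ V P 0 + bend V P 1 * κ V P 1) / 4 := by
      linear_combination (bend V P 0 * b0 + bend V P 1 * b1) / 2
    rw [hs, hb0, hb1, reducedQuartic]
    obtain ⟨Δ, hΔ⟩ : ∃ Δ, Δ = pd [0, 0] V P * pd [1, 1] V P - pd [0, 1] V P ^ 2 := ⟨_, rfl⟩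
    rw [← hΔ] at hd ⊢
    field_simp
    ring
  rw [h.dirDeriv_eq_zero, h.dirDeriv_eq_zero, D2_eq hV, hD,
    dirDeriv_softDir_three h.toIsSymmetricPotential, dirDeriv_softDir_four hV, e1, e2, e3, hq,
    frame_curve]
  simp only [softDir]
  ring

lemma isBigO_parabola (c : Fin 3 → ℝ) :
    (fun t : ℝ => t ^ 2 • c) =O[𝓝 0] fun t => t := by
  have h1 : (fun t : ℝ => t ^ 2) =O[𝓝 0] fun t => t := by
    simpa using pow_isBigO_pow (show 1 ≤ 2 by norm_num)
  refine (Asymptotics.IsBigO.of_bound ‖c‖ (Eventually.of_forall fun t => ?_)).trans h1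
  rw [norm_smul, mul_comm]

theorem IsSymmetricCritical.isDetermined_four (h : IsSymmetricCritical V P) (hD : D2 V P = 0)
    (hq : reducedQuartic V P ≠ 0) : IsDetermined 4 V P := by
  obtain ⟨β, hβ⟩ := h.exists_equiv (α V P)
  -- The line would only control `φ` modulo `t^4`; the parabola has `m = 3`, and `4 + 1 ≤ 2 * 3`.
  exact isDetermined_of_curve (frame (α V P)) h.contDiff (h.partialDeriv_eq_zero _) hβ
    (isBigO_parabola (bend V P)) (k := 4) (m := 3) (by norm_num) (by norm_num) (by norm_num)
    (isBigO_partialDeriv_parabola h)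
    (div_ne_zero hq (mul_ne_zero (by norm_num) h.det_pos.ne')) (h.value_parabola hD)

theorem IsSymmetricCritical.not_isDetermined_four (h : IsSymmetricCritical V P) (hD : D2 V P = 0)
    (hq : reducedQuartic V P = 0) : ¬ IsDetermined 4 V P := by
  obtain ⟨β, hβ⟩ := h.exists_equiv (α V P)
  refine not_isDetermined_of_curve (frame (α V P)) h.contDiff (h.partialDeriv_eq_zero _) hβ
    (isBigO_parabola (bend V P)) (k := 4) (m := 3) (c := V P) (by norm_num) (by norm_num)
    (by norm_num) (isBigO_partialDeriv_parabola h) ?_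
  have := h.value_parabola hD
  rw [hq] at this
  simpa using this

end Quartic

/-! ### Block structure and reduction of the general conditions. -/

section General

variable {V : (Fin 4 → ℝ) → ℝ} {P : Fin 4 → ℝ}

lemma IsSymmetricPotential.hessian_eq (h : IsSymmetricPotential V P) :
    hessian V P = !![pd [0, 0] V P, pd [0, 1] V P, 0, 0;
      pd [0, 1] V P, pd [1, 1] V P, 0, 0;
      0, 0, pd [2, 2] V P, pd [2, 3] V P;
      0, 0, pd [2, 3] V P, pd [3, 3] V P] := by
  have hV := h.contDiff
  ext i j
  change pd [i, j] V P = _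
  fin_cases i <;> fin_cases j <;> simp
  · exact h.pd_eq_zero (by decide)
  · exact h.pd_eq_zero (by decide)
  · rw [pd_perm hV (show List.Perm [1, 0] [0, 1] by decide)]
  · exact h.pd_eq_zero (by decide)
  · exact h.pd_eq_zero (by decide)
  · exact h.pd_eq_zero (by decide)
  · exact h.pd_eq_zero (by decide)
  · exact h.pd_eq_zero (by decide)
  · exact h.pd_eq_zero (by decide)
  · rw [pd_perm hV (show List.Perm [3, 2] [2, 3] by decide)]

lemma IsSymmetricPotential.det_H₂ (h : IsSymmetricPotential V P) :
    (H₂ V P).det = pd [2, 2] V P * pd [3, 3] V P - pd [2, 3] V P ^ 2 := by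
  rw [H₂, h.hessian_eq, Matrix.det_fin_two]
  simp
  ring

lemma IsSymmetricPotential.det_H₁ (h : IsSymmetricPotential V P) :
    (H₁ V P).det = pd [0, 0] V P * pd [1, 1] V P - pd [0, 1] V P ^ 2 := by
  rw [H₁, h.hessian_eq, Matrix.det_fin_two]
  simp
  ring

lemma IsSymmetricPotential.D2_eq_zero_iff (h : IsSymmetricPotential V P)
    (hzz : pd [2, 2] V P ≠ 0) : D2 V P = 0 ↔ (H₂ V P).det = 0 := by
  have : D2 V P * pd [2, 2] V P = (H₂ V P).det := by
    rw [h.det_H₂, D2, α]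
    field_simp
    ring
  rw [← this]
  simp [hzz]

lemma IsSymmetricPotential.D3_eq_zero (h : IsSymmetricPotential V P) : D3 V P = 0 := by
  rw [D3, h.pd_eq_zero (l := [2, 2, 2]) (by decide), h.pd_eq_zero (l := [2, 2, 3]) (by decide),
    h.pd_eq_zero (l := [2, 3, 3]) (by decide), h.pd_eq_zero (l := [3, 3, 3]) (by decide)]
  ring

/-- Since `κ₃ = 0`, only the minors with indices in `x, y` contribute. Each of them, like `det M`,
contains the factor `V_zz` by block diagonality. -/
lemma IsSymmetricPotential.generalQuartic_eq (h : IsSymmetricPotential V P) :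
    generalQuartic V P = pd [2, 2] V P * reducedQuartic V P := by
  have hM : matM V P = !![pd [0, 0] V P, pd [0, 1] V P, 0; pd [0, 1] V P, pd [1, 1] V P, 0;
      0, 0, pd [2, 2] V P] := by
    rw [matM, h.hessian_eq]
    ext i j
    fin_cases i <;> fin_cases j <;> rfl
  have h00 : minorM V P 0 0 = pd [1, 1] V P * pd [2, 2] V P := by
    rw [minorM, hM, Matrix.det_fin_two]
    simp
  have h01 : minorM V P 0 1 = pd [0, 1] V P * pd [2, 2] V P := by
    rw [minorM, hM, Matrix.det_fin_two]
    simp [Fin.succAbove]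
  have h10 : minorM V P 1 0 = pd [0, 1] V P * pd [2, 2] V P := by
    rw [minorM, hM, Matrix.det_fin_two]
    simp [Fin.succAbove]
  have h11 : minorM V P 1 1 = pd [0, 0] V P * pd [2, 2] V P := by
    rw [minorM, hM, Matrix.det_fin_two]
    simp [Fin.succAbove]
  rw [generalQuartic, hM, Matrix.det_fin_three]
  simp only [Fin.sum_univ_three, h.kappa_two, h00, h01, h10, h11, reducedQuartic]
  simp
  ring

lemma IsSymmetricCritical.of_posDef (h : IsSymmetricPotential V P) (hcrit : fderiv ℝ V P = 0)
    (hpos : (H₁ V P).PosDef) (hzz : pd [2, 2] V P ≠ 0) : IsSymmetricCritical V P :=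
  { h with
    fderiv_eq_zero := hcrit
    det_pos := by
      rw [← h.det_H₁]
      exact hpos.det_pos
    zz_ne_zero := hzz }

end General

/-- The classification of the degenerate critical points of symmetric potentials. -/
theorem symmetric_potential_determinacy {V : (Fin 4 → ℝ) → ℝ} {P : Fin 4 → ℝ} (hP2 : P 2 = 0)
    (hP3 : P 3 = 0) (hV : IsSmoothGerm V P)
    (hsym : ∀ᶠ p in 𝓝 P, V ![p 0, p 1, -p 2, -p 3] = V p) (hcrit : fderiv ℝ V P = 0)
    (hpos : (H₁ V P).PosDef) (hzz : pd [2, 2] V P ≠ 0) :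
    hessian V P = !![pd [0, 0] V P, pd [0, 1] V P, 0, 0;
      pd [0, 1] V P, pd [1, 1] V P, 0, 0;
      0, 0, pd [2, 2] V P, pd [2, 3] V P;
      0, 0, pd [2, 3] V P, pd [3, 3] V P] ∧
    (H₂ V P).det = pd [2, 2] V P * pd [3, 3] V P - pd [2, 3] V P ^ 2 ∧
    (D2 V P = 0 ↔ (H₂ V P).det = 0) ∧
    D3 V P = 0 ∧
    (generalQuartic V P = 0 ↔ reducedQuartic V P = 0) ∧
    (¬ IsDetermined 2 V P ↔ (H₂ V P).det = 0) ∧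
    (¬ IsDetermined 2 V P → ¬ IsDetermined 3 V P) ∧
    (¬ IsDetermined 3 V P ↔ (H₂ V P).det = 0) ∧
    (¬ IsDetermined 4 V P ↔ (H₂ V P).det = 0 ∧ reducedQuartic V P = 0) := by
  -- Both sides of every claim depend only on the germ, so `V` is replaced by a globally smooth `W`.
  obtain ⟨W, hW, hWV⟩ := hV.exists_contDiff
  have hpd : ∀ l, pd l V P = pd l W P := fun l => (pd_congr hWV l).self_of_nhds.symm
  have hdet : ∀ k, IsDetermined k V P ↔ IsDetermined k W P := fun k =>
    ⟨isDetermined_congr hWV.symm, isDetermined_congr hWV⟩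
  have hH : hessian V P = hessian W P := by
    ext i j
    exact hpd _
  have hH1 : H₁ V P = H₁ W P := by rw [H₁, H₁, hH]
  have hH2 : H₂ V P = H₂ W P := by rw [H₂, H₂, hH]
  have hM : matM V P = matM W P := by rw [matM, matM, hH]
  have hα : α V P = α W P := by simp only [α, hpd]
  have hκ : κ V P = κ W P := by
    funext i
    simp only [κ, hα, hpd]
  have hD2 : D2 V P = D2 W P := by simp only [D2, hα, hpd]
  have hD3 : D3 V P = D3 W P := by simp only [D3, hα, hpd]
  have hD4 : D4 V P = D4 W P := by simp only [D4, hα, hpd]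
  have hgq : generalQuartic V P = generalQuartic W P := by
    simp only [generalQuartic, minorM, hM, hκ, hD4]
  have hrq : reducedQuartic V P = reducedQuartic W P := by
    simp only [reducedQuartic, hκ, hD4, hpd]
  have hsymW : IsSymmetricPotential W P := by
    refine ⟨hW, ?_, hP2, hP3⟩
    have hc : Tendsto (fun p : Fin 4 → ℝ => (![p 0, p 1, -p 2, -p 3] : Fin 4 → ℝ)) (𝓝 P) (𝓝 P) := by
      refine Continuous.tendsto' ?_ _ _ ?_
      · refine continuous_pi fun i => ?_
        fin_cases i <;> simp <;> fun_prop
      · ext i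
        fin_cases i <;> simp [hP2, hP3]
    filter_upwards [hsym, hWV, hc.eventually hWV] with p h1 h2 h3
    rw [h3, h1, h2]
  rw [hpd] at hzz
  rw [hH1] at hpos
  have hW' := IsSymmetricCritical.of_posDef hsymW (by rw [hWV.fderiv_eq, hcrit]) hpos hzz
  simp only [hdet, hgq, hrq, hD2, hD3, hH2, hH, hpd]
  have hD := hsymW.D2_eq_zero_iff hzz
  have h23 : IsDetermined 2 W P → IsDetermined 3 W P := isDetermined_mono (by norm_num)
  have h34 : IsDetermined 3 W P → IsDetermined 4 W P := isDetermined_mono (by norm_num)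
  have h2 : D2 W P ≠ 0 → IsDetermined 2 W P := hW'.isDetermined_two
  have h3 : D2 W P = 0 → ¬ IsDetermined 3 W P := hW'.not_isDetermined_three
  have h4 : D2 W P = 0 → reducedQuartic W P ≠ 0 → IsDetermined 4 W P := hW'.isDetermined_four
  have h4' : D2 W P = 0 → reducedQuartic W P = 0 → ¬ IsDetermined 4 W P :=
    hW'.not_isDetermined_four
  refine ⟨hsymW.hessian_eq, hsymW.det_H₂, hD, hsymW.D3_eq_zero, ?_, ?_, ?_, ?_, ?_⟩
  · rw [hsymW.generalQuartic_eq]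
    simp [hzz]
  · tauto
  · tauto
  · tauto
  · tauto

/-! ### Potentials with two order parameters or one. -/

section OrderParameters

/-- The projection onto the variables `x, w`. -/
def projXW (p : Fin 4 → ℝ) : Fin 2 → ℝ := ![p 0, p 3]

lemma projXW_eq : projXW = fun p => ContinuousLinearMap.pi
    (![ContinuousLinearMap.proj 0, ContinuousLinearMap.proj 3] :
      Fin 2 → (Fin 4 → ℝ) →L[ℝ] ℝ) p := by
  funext p
  ext i
  fin_cases i <;> rfl

lemma continuous_projXW : Continuous projXW := by
  rw [projXW_eq]
  exact ContinuousLinearMap.continuous _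

lemma contDiff_projXW : ContDiff ℝ ∞ projXW := by
  rw [projXW_eq]
  exact ContinuousLinearMap.contDiff _

/-- The projection is linear, so derivatives of `g(x, w)` are derivatives of `g` along projected
directions; those along `y` and `z` vanish because these directions project to zero. -/
lemma dirDeriv_comp_projXW {g : (Fin 2 → ℝ) → ℝ} (hg : ContDiff ℝ ∞ g) (v : Fin 4 → ℝ) :
    dirDeriv v (g ∘ projXW) = dirDeriv (projXW v) g ∘ projXW := by
  funext p
  have h1 : HasFDerivAt projXW (ContinuousLinearMap.pi
      (![ContinuousLinearMap.proj 0, ContinuousLinearMap.proj 3] :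
        Fin 2 → (Fin 4 → ℝ) →L[ℝ] ℝ)) p := by
    rw [projXW_eq]
    exact ContinuousLinearMap.hasFDerivAt _
  have h2 := ((hg.differentiable (by simp) (projXW p)).hasFDerivAt.comp p h1).fderiv
  rw [dirDeriv, h2, projXW_eq]
  rfl

lemma projXW_single_zero : projXW (Pi.single 0 1) = Pi.single 0 1 := by
  ext i
  fin_cases i <;> simp [projXW]

lemma projXW_single_one : projXW (Pi.single 1 1) = 0 := by
  ext i
  fin_cases i <;> simp [projXW]

lemma projXW_single_two : projXW (Pi.single 2 1) = 0 := by
  ext i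
  fin_cases i <;> simp [projXW]

lemma projXW_single_three : projXW (Pi.single 3 1) = Pi.single 1 1 := by
  ext i
  fin_cases i <;> simp [projXW]

lemma twoParameter_eq (g : (Fin 2 → ℝ) → ℝ) :
    twoParameter g = fun p => 1 / 2 * p 1 ^ 2 + 1 / 2 * p 2 ^ 2 + (g ∘ projXW) p := rfl

lemma dirDeriv_twoParameter {g : (Fin 2 → ℝ) → ℝ} (hg : ContDiff ℝ ∞ g) (v p : Fin 4 → ℝ) :
    dirDeriv v (twoParameter g) p =
      p 1 * v 1 + p 2 * v 2 + dirDeriv (projXW v) g (projXW p) := by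
  have hq : ∀ i : Fin 4, HasFDerivAt (fun p : Fin 4 → ℝ => 1 / 2 * p i ^ 2)
      ((p i) • (ContinuousLinearMap.proj i : (Fin 4 → ℝ) →L[ℝ] ℝ)) p := fun i => by
    have h1 : HasFDerivAt (fun p : Fin 4 → ℝ => p i)
      (ContinuousLinearMap.proj i : (Fin 4 → ℝ) →L[ℝ] ℝ) p := hasFDerivAt_apply i p
    refine ((h1.pow 2).const_mul (1 / 2)).congr_fderiv ?_
    ext v
    simp
    ring
  have hd := ((hg.comp contDiff_projXW).differentiable (by simp) p).hasFDerivAt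
  have h2 := (((hq 1).add (hq 2)).add hd).fderiv
  have h3 := congrFun (dirDeriv_comp_projXW hg v) p
  rw [dirDeriv] at h3
  rw [dirDeriv, twoParameter_eq]
  rw [show fderiv ℝ (fun p : Fin 4 → ℝ => 1 / 2 * p 1 ^ 2 + 1 / 2 * p 2 ^ 2 + (g ∘ projXW) p) p = _
    from h2]
  simp only [_root_.add_apply, _root_.smul_apply, h3]
  simp

lemma dirDeriv_coord {n : ℕ} (v : Fin n → ℝ) (i : Fin n) :
    dirDeriv v (fun p : Fin n → ℝ => p i) = fun _ => v i := by
  funext p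
  rw [dirDeriv, (hasFDerivAt_apply i p).fderiv]
  rfl

variable {g : (Fin 2 → ℝ) → ℝ}

lemma dirDeriv_zero_comp_projXW (hg : ContDiff ℝ ∞ g) :
    dirDeriv (Pi.single 0 1) (g ∘ projXW) = pd [0] g ∘ projXW := by
  rw [dirDeriv_comp_projXW hg, projXW_single_zero]
  rfl

lemma dirDeriv_three_comp_projXW (hg : ContDiff ℝ ∞ g) :
    dirDeriv (Pi.single 3 1) (g ∘ projXW) = pd [1] g ∘ projXW := by
  rw [dirDeriv_comp_projXW hg, projXW_single_three]
  rfl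

lemma dirDeriv_one_comp_projXW (hg : ContDiff ℝ ∞ g) :
    dirDeriv (Pi.single 1 1) (g ∘ projXW) = fun _ => 0 := by
  rw [dirDeriv_comp_projXW hg, projXW_single_one]
  funext p
  exact dirDeriv_zero_left _ _

lemma dirDeriv_two_comp_projXW (hg : ContDiff ℝ ∞ g) :
    dirDeriv (Pi.single 2 1) (g ∘ projXW) = fun _ => 0 := by
  rw [dirDeriv_comp_projXW hg, projXW_single_two]
  funext p
  exact dirDeriv_zero_left _ _

lemma pd_zero_twoParameter (hg : ContDiff ℝ ∞ g) :
    pd [0] (twoParameter g) = pd [0] g ∘ projXW := by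
  funext p
  change dirDeriv (Pi.single 0 1) (twoParameter g) p = _
  rw [dirDeriv_twoParameter hg, projXW_single_zero]
  simp
  rfl

lemma pd_one_twoParameter (hg : ContDiff ℝ ∞ g) :
    pd [1] (twoParameter g) = fun p => p 1 := by
  funext p
  change dirDeriv (Pi.single 1 1) (twoParameter g) p = _
  rw [dirDeriv_twoParameter hg, projXW_single_one, dirDeriv_zero_left]
  simp

lemma pd_two_twoParameter (hg : ContDiff ℝ ∞ g) :
    pd [2] (twoParameter g) = fun p => p 2 := by
  funext p
  change dirDeriv (Pi.single 2 1) (twoParameter g) p = _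
  rw [dirDeriv_twoParameter hg, projXW_single_two, dirDeriv_zero_left]
  simp

lemma pd_three_twoParameter (hg : ContDiff ℝ ∞ g) :
    pd [3] (twoParameter g) = pd [1] g ∘ projXW := by
  funext p
  change dirDeriv (Pi.single 3 1) (twoParameter g) p = _
  rw [dirDeriv_twoParameter hg, projXW_single_three]
  simp
  rfl

lemma contDiff_twoParameter (hg : ContDiff ℝ ∞ g) : ContDiff ℝ ∞ (twoParameter g) := by
  rw [twoParameter_eq]
  exact (by fun_prop : ContDiff ℝ ∞ fun p : Fin 4 → ℝ => 1 / 2 * p 1 ^ 2 + 1 / 2 * p 2 ^ 2).add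
    (hg.comp contDiff_projXW)

/-- The second derivatives of `½ y² + ½ z² + g(x, w)`. -/
lemma hessian_twoParameter (hg : ContDiff ℝ ∞ g) (P : Fin 4 → ℝ) :
    hessian (twoParameter g) P =
      !![pd [0, 0] g (projXW P), 0, 0, pd [0, 1] g (projXW P);
        0, 1, 0, 0; 0, 0, 1, 0;
        pd [0, 1] g (projXW P), 0, 0, pd [1, 1] g (projXW P)] := by
  have hg0 := contDiff_pd hg [0]
  have hg1 := contDiff_pd hg [1]
  ext i j
  change dirDeriv (Pi.single i 1) (pd [j] (twoParameter g)) P = _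
  fin_cases i <;> fin_cases j <;>
    simp [pd_zero_twoParameter hg, pd_one_twoParameter hg, pd_two_twoParameter hg,
      pd_three_twoParameter hg, dirDeriv_zero_comp_projXW hg0, dirDeriv_zero_comp_projXW hg1,
      dirDeriv_one_comp_projXW hg0, dirDeriv_one_comp_projXW hg1, dirDeriv_two_comp_projXW hg0,
      dirDeriv_two_comp_projXW hg1, dirDeriv_three_comp_projXW hg0,
      dirDeriv_three_comp_projXW hg1, dirDeriv_coord]
  · rfl
  · rfl
  · exact congrFun (pd_perm hg (show List.Perm [1, 0] [0, 1] by decide)) _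
  · rfl

lemma reducedQuartic_twoParameter (hg : ContDiff ℝ ∞ g) (P : Fin 4 → ℝ) :
    reducedQuartic (twoParameter g) P =
      pd [0, 0] g (projXW P) * pd [1, 1, 1, 1] g (projXW P) - 3 * pd [0, 1, 1] g (projXW P) ^ 2 := by
  have hH : ∀ i j, pd [i, j] (twoParameter g) P = hessian (twoParameter g) P i j := fun _ _ => rfl
  have h33 : pd [3, 3] (twoParameter g) = pd [1, 1] g ∘ projXW := by
    rw [pd_cons, pd_three_twoParameter hg, dirDeriv_three_comp_projXW (contDiff_pd hg _)]
    rfl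
  have h4 : pd [3, 3, 3, 3] (twoParameter g) = pd [1, 1, 1, 1] g ∘ projXW := by
    rw [pd_cons, pd_cons, h33, dirDeriv_three_comp_projXW (contDiff_pd hg _),
      dirDeriv_three_comp_projXW (contDiff_pd (contDiff_pd hg _) _)]
    rfl
  have h033 : pd [0, 3, 3] (twoParameter g) = pd [0, 1, 1] g ∘ projXW := by
    rw [pd_cons, h33, dirDeriv_zero_comp_projXW (contDiff_pd hg _)]
    rfl
  have h133 : pd [1, 3, 3] (twoParameter g) = fun _ => 0 := by
    rw [pd_cons, h33, dirDeriv_one_comp_projXW (contDiff_pd hg _)]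
  -- There is no `z, w` coupling, so the soft direction is the `w` axis and only pure `w`
  -- derivatives survive in `D4` and `κ`.
  have hα : α (twoParameter g) P = 0 := by
    rw [α, hH, hessian_twoParameter hg]
    simp
  have hD4 : D4 (twoParameter g) P = pd [1, 1, 1, 1] g (projXW P) := by
    rw [D4, hα, h4]
    simp
  have hκ0 : κ (twoParameter g) P 0 = pd [0, 1, 1] g (projXW P) := by
    change α (twoParameter g) P ^ 2 * _ - 2 * α (twoParameter g) P * _
      + pd [0, 3, 3] (twoParameter g) P = _
    rw [hα, h033]
    simp
  have hκ1 : κ (twoParameter g) P 1 = 0 := by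
    change α (twoParameter g) P ^ 2 * _ - 2 * α (twoParameter g) P * _
      + pd [1, 3, 3] (twoParameter g) P = _
    rw [hα, h133]
    simp
  rw [reducedQuartic, hD4, hκ0, hκ1, hH, hH, hH, hessian_twoParameter hg]
  simp

lemma fderiv_twoParameter_eq_zero (hg : ContDiff ℝ ∞ g) {P : Fin 4 → ℝ} (h1 : P 1 = 0)
    (h2 : P 2 = 0) (h : fderiv ℝ g (projXW P) = 0) : fderiv ℝ (twoParameter g) P = 0 := by
  refine ContinuousLinearMap.ext fun v => ?_
  change dirDeriv v (twoParameter g) P = 0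
  rw [dirDeriv_twoParameter hg, h1, h2, dirDeriv, h]
  simp

/-- The case of two order parameters. -/
theorem twoParameter_determinacy {Q : Fin 2 → ℝ} {P : Fin 4 → ℝ} (hPQ : projXW P = Q)
    (hP1 : P 1 = 0) (hP2 : P 2 = 0) (hP3 : P 3 = 0) (hg : IsSmoothGerm g Q)
    (hsym : ∀ᶠ q in 𝓝 Q, g ![q 0, -q 1] = g q) (hcrit : fderiv ℝ g Q = 0)
    (hpos : 0 < pd [0, 0] g Q) :
    (H₂ (twoParameter g) P).det = pd [1, 1] g Q ∧
    reducedQuartic (twoParameter g) P =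
      pd [0, 0] g Q * pd [1, 1, 1, 1] g Q - 3 * pd [0, 1, 1] g Q ^ 2 ∧
    (¬ IsDetermined 2 (twoParameter g) P ↔ pd [1, 1] g Q = 0) ∧
    (¬ IsDetermined 3 (twoParameter g) P ↔ pd [1, 1] g Q = 0) ∧
    (¬ IsDetermined 4 (twoParameter g) P ↔ pd [1, 1] g Q = 0 ∧
      pd [0, 0] g Q * pd [1, 1, 1, 1] g Q - 3 * pd [0, 1, 1] g Q ^ 2 = 0) := by
  obtain ⟨G, hG, hGg⟩ := hg.exists_contDiff
  subst hPQ
  have hπ : Tendsto projXW (𝓝 P) (𝓝 (projXW P)) := continuous_projXW.continuousAt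
  have hT : twoParameter g =ᶠ[𝓝 P] twoParameter G := by
    filter_upwards [hπ.eventually hGg] with p hp
    change _ + g (projXW p) = _ + G (projXW p)
    rw [hp]
  have hgp : ∀ l, pd l g (projXW P) = pd l G (projXW P) := fun l =>
    (pd_congr hGg l).self_of_nhds.symm
  have hTp : ∀ l, pd l (twoParameter g) P = pd l (twoParameter G) P := fun l =>
    (pd_congr hT l).self_of_nhds
  have hH : hessian (twoParameter g) P = hessian (twoParameter G) P := by
    ext i j
    exact hTp _
  have hdet : (H₂ (twoParameter g) P).det = pd [1, 1] g (projXW P) := by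
    rw [H₂, hH, hessian_twoParameter hG, Matrix.det_fin_two, hgp]
    simp
  have hrq : reducedQuartic (twoParameter g) P = pd [0, 0] g (projXW P) *
      pd [1, 1, 1, 1] g (projXW P) - 3 * pd [0, 1, 1] g (projXW P) ^ 2 := by
    have : reducedQuartic (twoParameter g) P = reducedQuartic (twoParameter G) P := by
      simp only [reducedQuartic, D4, κ, α, hTp]
    rw [this, reducedQuartic_twoParameter hG, hgp, hgp, hgp]
  have hH1 : (H₁ (twoParameter g) P).PosDef := by
    have : H₁ (twoParameter g) P = Matrix.diagonal ![pd [0, 0] g (projXW P), 1] := by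
      rw [H₁, hH, hessian_twoParameter hG, hgp]
      ext i j
      fin_cases i <;> fin_cases j <;> simp
    rw [this, Matrix.posDef_diagonal_iff]
    intro i
    fin_cases i
    · exact hpos
    · exact one_pos
  have hmain := symmetric_potential_determinacy hP2 hP3
    (((contDiff_twoParameter hG).isSmoothGerm P).congr hT) ?_
    (by rw [hT.fderiv_eq]; exact fderiv_twoParameter_eq_zero hG hP1 hP2 (by rw [hGg.fderiv_eq, hcrit]))
    hH1 ?_
  · obtain ⟨-, -, -, -, -, h2, -, h3, h4⟩ := hmain
    rw [hdet] at h2 h3 h4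
    rw [hrq] at h4
    exact ⟨hdet, hrq, h2, h3, h4⟩
  · filter_upwards [hπ.eventually hsym] with p hp
    have e1 : projXW ![p 0, p 1, -p 2, -p 3] = ![(projXW p) 0, -(projXW p) 1] := rfl
    change 1 / 2 * (p 1) ^ 2 + 1 / 2 * (-p 2) ^ 2 + g (projXW ![p 0, p 1, -p 2, -p 3]) =
      1 / 2 * (p 1) ^ 2 + 1 / 2 * (p 2) ^ 2 + g (projXW p)
    rw [e1, hp, neg_sq]
  · rw [hTp, show pd [2, 2] (twoParameter G) P = hessian (twoParameter G) P 2 2 from rfl,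
      hessian_twoParameter hG]
    simp

/-- The function `½ x² + f(w)` of two variables. -/
noncomputable def oneToTwo (f : ℝ → ℝ) (q : Fin 2 → ℝ) : ℝ := 1 / 2 * q 0 ^ 2 + f (q 1)

lemma oneParameter_eq (f : ℝ → ℝ) : oneParameter f = twoParameter (oneToTwo f) := by
  funext p
  simp only [oneParameter, twoParameter, oneToTwo, Matrix.cons_val_zero, Matrix.cons_val_one]
  ring

lemma dirDeriv_comp_coord {f : ℝ → ℝ} (hf : ContDiff ℝ ∞ f) (v : Fin 2 → ℝ) :
    dirDeriv v (fun q : Fin 2 → ℝ => f (q 1)) = fun q => v 1 * deriv f (q 1) := by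
  funext q
  have h := ((hf.differentiable (by simp) (q 1)).hasDerivAt.comp_hasFDerivAt q
    (hasFDerivAt_apply (𝕜 := ℝ) 1 q)).fderiv
  rw [dirDeriv, show fderiv ℝ (fun q : Fin 2 → ℝ => f (q 1)) q = _ from h]
  simp [mul_comm]

lemma dirDeriv_oneToTwo {f : ℝ → ℝ} (hf : ContDiff ℝ ∞ f) (v : Fin 2 → ℝ) :
    dirDeriv v (oneToTwo f) = fun q => q 0 * v 0 + v 1 * deriv f (q 1) := by
  funext q
  have h1 : HasFDerivAt (fun q : Fin 2 → ℝ => 1 / 2 * q 0 ^ 2) _ q :=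
    ((hasFDerivAt_apply (𝕜 := ℝ) 0 q).pow 2).const_mul (1 / 2)
  have h2 : DifferentiableAt ℝ (fun q : Fin 2 → ℝ => f (q 1)) q :=
    (hf.differentiable (by simp) (q 1)).comp q (differentiableAt_apply 1 q)
  have h3 := (h1.add h2.hasFDerivAt).fderiv
  have h4 := congrFun (dirDeriv_comp_coord hf v) q
  rw [dirDeriv] at h4
  rw [dirDeriv, show fderiv ℝ (oneToTwo f) q = _ from h3, _root_.add_apply, h4]
  simp
  ring

lemma pd_one_comp_coord {f : ℝ → ℝ} (hf : ContDiff ℝ ∞ f) :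
    dirDeriv (Pi.single 1 1) (fun q : Fin 2 → ℝ => f (q 1)) = fun q => deriv f (q 1) := by
  rw [dirDeriv_comp_coord hf]
  simp

lemma contDiff_oneToTwo {f : ℝ → ℝ} (hf : ContDiff ℝ ∞ f) : ContDiff ℝ ∞ (oneToTwo f) :=
  (by fun_prop : ContDiff ℝ ∞ fun q : Fin 2 → ℝ => 1 / 2 * q 0 ^ 2).add
    (hf.comp (contDiff_apply ℝ ℝ (1 : Fin 2)))

/-- The case of one order parameter. -/
theorem oneParameter_determinacy {f : ℝ → ℝ} (hf : IsSmoothGerm f 0)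
    (hsym : ∀ᶠ t in 𝓝 (0 : ℝ), f (-t) = f t) :
    (H₂ (oneParameter f) 0).det = iteratedDeriv 2 f 0 ∧
    reducedQuartic (oneParameter f) 0 = iteratedDeriv 4 f 0 ∧
    (¬ IsDetermined 2 (oneParameter f) 0 ↔ iteratedDeriv 2 f 0 = 0) ∧
    (¬ IsDetermined 3 (oneParameter f) 0 ↔ iteratedDeriv 2 f 0 = 0) ∧
    (¬ IsDetermined 4 (oneParameter f) 0 ↔ iteratedDeriv 2 f 0 = 0 ∧ iteratedDeriv 4 f 0 = 0) := by
  obtain ⟨F, hF, hFf⟩ := hf.exists_contDiff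
  have hc : Tendsto (fun q : Fin 2 → ℝ => q 1) (𝓝 0) (𝓝 0) :=
    (continuous_apply 1).tendsto' _ _ rfl
  have hg : oneToTwo f =ᶠ[𝓝 0] oneToTwo F := by
    filter_upwards [hc.eventually hFf] with q hq
    rw [oneToTwo, oneToTwo, hq]
  have hpd : ∀ l, pd l (oneToTwo f) 0 = pd l (oneToTwo F) 0 := fun l =>
    (pd_congr hg l).self_of_nhds
  have hF1 : ContDiff ℝ ∞ (deriv F) := (contDiff_infty_iff_deriv.1 hF).2
  have hF2 : ContDiff ℝ ∞ (deriv (deriv F)) := (contDiff_infty_iff_deriv.1 hF1).2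
  have hF3 : ContDiff ℝ ∞ (deriv (deriv (deriv F))) := (contDiff_infty_iff_deriv.1 hF2).2
  have p0 : pd [0] (oneToTwo F) = fun q => q 0 := by
    rw [pd_cons, pd, dirDeriv_oneToTwo hF]
    simp
  have p1 : pd [1] (oneToTwo F) = fun q => deriv F (q 1) := by
    rw [pd_cons, pd, dirDeriv_oneToTwo hF]
    simp
  have p00 : pd [0, 0] (oneToTwo F) = fun _ => 1 := by
    rw [pd_cons, p0, dirDeriv_coord]
    simp
  have p11 : pd [1, 1] (oneToTwo F) = fun q => deriv (deriv F) (q 1) := by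
    rw [pd_cons, p1, pd_one_comp_coord hF1]
  have p011 : pd [0, 1, 1] (oneToTwo F) = fun _ => 0 := by
    rw [pd_cons, p11, dirDeriv_comp_coord hF2]
    simp
  have p1111 : pd [1, 1, 1, 1] (oneToTwo F) = fun q => deriv (deriv (deriv (deriv F))) (q 1) := by
    rw [pd_cons, pd_cons, p11, pd_one_comp_coord hF2, pd_one_comp_coord hF3]
  -- Criticality is not assumed for one order parameter; it follows from evenness.
  have hd : deriv F 0 = 0 := by
    have hev : (fun t => F (-t)) =ᶠ[𝓝 0] F := by
      have hn : Tendsto (fun t : ℝ => -t) (𝓝 0) (𝓝 0) := continuous_neg.tendsto' _ _ neg_zero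
      filter_upwards [hsym, hFf, hn.eventually hFf] with t h1 h2 h3
      rw [h3, h1, h2]
    have h1 := hev.deriv_eq
    rw [deriv_comp_neg, neg_zero] at h1
    linarith
  have h2 : iteratedDeriv 2 f 0 = deriv (deriv F) 0 := by
    rw [← (hFf.iteratedDeriv 2).self_of_nhds, iteratedDeriv_eq_iterate]
    rfl
  have h4 : iteratedDeriv 4 f 0 = deriv (deriv (deriv (deriv F))) 0 := by
    rw [← (hFf.iteratedDeriv 4).self_of_nhds, iteratedDeriv_eq_iterate]
    rfl
  have hmain := twoParameter_determinacy (g := oneToTwo f) (Q := 0) (P := 0)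
    (by ext i; fin_cases i <;> rfl) rfl rfl rfl
    (((contDiff_oneToTwo hF).isSmoothGerm 0).congr hg) ?_ ?_ ?_
  · rw [← oneParameter_eq] at hmain
    simp only [hpd, p00, p11, p011, p1111] at hmain
    simpa [h2, h4] using hmain
  · filter_upwards [hc.eventually hsym] with q hq
    change 1 / 2 * (q 0) ^ 2 + f (-q 1) = 1 / 2 * (q 0) ^ 2 + f (q 1)
    rw [hq]
  · refine ContinuousLinearMap.ext fun v => ?_
    rw [hg.fderiv_eq]
    have := congrFun (dirDeriv_oneToTwo hF v) 0
    rw [dirDeriv] at this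
    rw [this]
    simp [hd]
  · rw [hpd, p00]
    exact one_pos

end OrderParameters

end Tricritical

theorem mainTheorem2 :
    -- potentials that are even in (z, w), at a critical point P = (x₀, y₀, 0, 0)
    (∀ (V : (Fin 4 → ℝ) → ℝ) (x₀ y₀ : ℝ) (P : Fin 4 → ℝ), P = ![x₀, y₀, 0, 0] →
      Tricritical.IsSmoothGerm V P →
      (∀ᶠ p in 𝓝 P, V ![p 0, p 1, -p 2, -p 3] = V p) →
      fderiv ℝ V P = 0 →
      (Tricritical.H₁ V P).PosDef →
      Tricritical.pd [2, 2] V P ≠ 0 →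
        -- the Hessian is block diagonal
        Tricritical.hessian V P =
          !![Tricritical.pd [0, 0] V P, Tricritical.pd [0, 1] V P, 0, 0;
             Tricritical.pd [0, 1] V P, Tricritical.pd [1, 1] V P, 0, 0;
             0, 0, Tricritical.pd [2, 2] V P, Tricritical.pd [2, 3] V P;
             0, 0, Tricritical.pd [2, 3] V P, Tricritical.pd [3, 3] V P] ∧
        (Tricritical.H₂ V P).det =
          Tricritical.pd [2, 2] V P * Tricritical.pd [3, 3] V P
            - Tricritical.pd [2, 3] V P ^ 2 ∧
        -- the three general conditions reduce to two equations
        (Tricritical.D2 V P = 0 ↔ (Tricritical.H₂ V P).det = 0) ∧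
        Tricritical.D3 V P = 0 ∧
        (Tricritical.generalQuartic V P = 0 ↔ Tricritical.reducedQuartic V P = 0) ∧
        -- these equations characterize the failure of determinacy
        (¬ Tricritical.IsDetermined 2 V P ↔ (Tricritical.H₂ V P).det = 0) ∧
        (¬ Tricritical.IsDetermined 2 V P → ¬ Tricritical.IsDetermined 3 V P) ∧
        (¬ Tricritical.IsDetermined 3 V P ↔ (Tricritical.H₂ V P).det = 0) ∧
        (¬ Tricritical.IsDetermined 4 V P ↔
          (Tricritical.H₂ V P).det = 0 ∧ Tricritical.reducedQuartic V P = 0)) ∧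
    -- two order parameters: V = ½ y² + ½ z² + g(x, w)
    (∀ (g : (Fin 2 → ℝ) → ℝ) (x₀ : ℝ) (Q : Fin 2 → ℝ) (P : Fin 4 → ℝ),
      Q = ![x₀, 0] → P = ![x₀, 0, 0, 0] →
      Tricritical.IsSmoothGerm g Q →
      (∀ᶠ q in 𝓝 Q, g ![q 0, -q 1] = g q) →
      fderiv ℝ g Q = 0 →
      0 < Tricritical.pd [0, 0] g Q →
        (Tricritical.H₂ (Tricritical.twoParameter g) P).det = Tricritical.pd [1, 1] g Q ∧
        Tricritical.reducedQuartic (Tricritical.twoParameter g) P =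
          Tricritical.pd [0, 0] g Q * Tricritical.pd [1, 1, 1, 1] g Q
            - 3 * Tricritical.pd [0, 1, 1] g Q ^ 2 ∧
        (¬ Tricritical.IsDetermined 2 (Tricritical.twoParameter g) P ↔
          Tricritical.pd [1, 1] g Q = 0) ∧
        (¬ Tricritical.IsDetermined 3 (Tricritical.twoParameter g) P ↔
          Tricritical.pd [1, 1] g Q = 0) ∧
        (¬ Tricritical.IsDetermined 4 (Tricritical.twoParameter g) P ↔
          Tricritical.pd [1, 1] g Q = 0 ∧
          Tricritical.pd [0, 0] g Q * Tricritical.pd [1, 1, 1, 1] g Q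
            - 3 * Tricritical.pd [0, 1, 1] g Q ^ 2 = 0)) ∧
    -- one order parameter: V = ½ x² + ½ y² + ½ z² + f(w)
    (∀ f : ℝ → ℝ,
      Tricritical.IsSmoothGerm f 0 →
      (∀ᶠ t in 𝓝 (0 : ℝ), f (-t) = f t) →
        (Tricritical.H₂ (Tricritical.oneParameter f) 0).det = iteratedDeriv 2 f 0 ∧
        Tricritical.reducedQuartic (Tricritical.oneParameter f) 0 = iteratedDeriv 4 f 0 ∧
        (¬ Tricritical.IsDetermined 2 (Tricritical.oneParameter f) 0 ↔
          iteratedDeriv 2 f 0 = 0) ∧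
        (¬ Tricritical.IsDetermined 3 (Tricritical.oneParameter f) 0 ↔
          iteratedDeriv 2 f 0 = 0) ∧
        (¬ Tricritical.IsDetermined 4 (Tricritical.oneParameter f) 0 ↔
          iteratedDeriv 2 f 0 = 0 ∧ iteratedDeriv 4 f 0 = 0)) := by
  refine ⟨?_, ?_, ?_⟩
  · rintro V x₀ y₀ P rfl hV hsym hcrit hpos hzz
    exact Tricritical.symmetric_potential_determinacy rfl rfl hV hsym hcrit hpos hzz
  · rintro g x₀ Q P rfl rfl hg hsym hcrit hpos
    exact Tricritical.twoParameter_determinacy (by ext i; fin_cases i <;> rfl) rfl rfl rfl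
      hg hsym hcrit hpos
  · intro f hf hsym
    exact Tricritical.oneParameter_determinacy hf hsym
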